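/- Let $m\ge 6$ be even. Let $H_m$ be the binary $m\times\binom m2$ matrix whose columns are all the binary vectors of length $m$ and weight $2$, each occurring once, and let $C^{(m)}$ be the binary linear code of length $\binom m2$ with parity check matrix $H_m$. Write $d(x,C)$ for the Hamming distance of a vector $x$ from a code $C$, $\rho(C)=\max_x d(x,C)$ for its covering radius and $C(i)=\{x: d(x,C)=i\}$. Put $C^{[m]}=C^{(m)}\cup C^{(m)}(\rho(C^{(m)}))$. A code $C$ with covering radius $\rho$ is completely regular with intersection array $(b_0,\dots,b_{\rho-1};c_1,\dots,c_\rho)$ if each $x\in C(i)$ has exactly $b_i$ neighbours (vectors at Hamming distance $1$) in $C(i+1)$ for $0\le i<\rho$, and exactly $c_i$ neighbours in $C(i-1)$ for $1\le i\le\rho$. The coset graph of $C$ has the cosets $C+x$ as vertices, two distinct cosets being adjacent when they contain vectors at Hamming distance $1$. Let $\Gamma^{(m)}$ and $\Gamma^{[m]}$ be the coset graphs of $C^{(m)}$ and $C^{[m]}$. Then $C^{[m]}$ is linear, and the following hold. (i) $\Gamma^{(m)}$ and $\Gamma^{[m]}$ are connected, have $2^{m-1}$ and $2^{m-2}$ vertices,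 and have diameters $m/2$ and $\lfloor m/4\rfloor$, which are also the covering radii of $C^{(m)}$ and $C^{[m]}$. The map sending a coset of $C^{(m)}$ to the coset of $C^{[m]}$ containing it makes $\Gamma^{(m)}$ a double cover of $\Gamma^{[m]}$: all its fibres have two elements, and it maps the neighbours of each vertex bijectively onto the neighbours of its image. (ii) The codes are completely regular, the graphs are distance-regular, and each graph has the same intersection array $(b_0,\dots,b_{\rho-1};c_1,\dots,c_\rho)$ as its code. For $\Gamma^{(m)}$, with $\rho=m/2$, it is given by $b_i=\binom{m-2i}{2}$ and $c_i=\binom{2i}{2}$. For $\Gamma^{[m]}$, with $\rho=\lfloor m/4\rfloor$, it is given by the same formulas, except that $c_\rho=2\binom{2\rho}{2}$ if $m\equiv 0\pmod 4$. (iii) Both graphs are distance-transitive: for vertices $u,v,u',v'$ with $d(u,v)=d(u',v')$ there is an automorphism taking $u$ to $u'$ and $v$ to $v'$. (iv) Call a connected graph primitive if, for each $i$ from $1$ to its diameter, the graph on the same vertices that joins the pairs at distance $i$ is connected, and imprimitive otherwise. Then $\Gamma^{(m)}$ is imprimitive and $\Gamma^{[m]}$ is primitive. (v) Put $\rho=\lfloor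 m/4\rfloor$. The set of eigenvalues of the adjacency matrix of $\Gamma^{[m]}$ is $$\Big\{\tbinom m2-8i(2\rho+1-i): i=0,1,\dots,\rho\Big\}\quad\text{if } m\equiv 2\pmod 4,$$ $$\Big\{\tbinom m2-8i(2\rho-i): i=0,1,\dots,\rho\Big\}\quad\text{if } m\equiv 0\pmod 4.$$ -/

import Mathlib

namespace CosetCode

open scoped Classical

/-! ### Binary codes -/

section Codes

variable {ι : Type*} [Fintype ι]

/-- The distance `d(v, C) = min {d(v, x) : x ∈ C}` from a vector to a (nonempty) binary code. -/
noncomputable def distTo (C : Set (ι → ZMod 2)) (v : ι → ZMod 2) : ℕ :=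
  sInf {d : ℕ | ∃ x ∈ C, hammingDist v x = d}

/-- The covering radius `max {d(v, C) : v ∈ 𝔽₂ⁿ}`. -/
noncomputable def coveringRadius (C : Set (ι → ZMod 2)) : ℕ :=
  Finset.univ.sup (distTo C)

/-- The set `C(i)` of all vectors at distance `i` from `C`. -/
def layer (C : Set (ι → ZMod 2)) (i : ℕ) : Set (ι → ZMod 2) :=
  {x | distTo C x = i}

/-- `C` is completely regular with covering radius `ρ` and intersection array
`(b 0, …, b (ρ - 1); c 1, …, c ρ)`. Only these values of `b` and `c` matter; the remaining numbers
`c_0` and `b_ρ` of the array are `0`. -/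
structure IsCompletelyRegularWith (C : Set (ι → ZMod 2)) (ρ : ℕ) (b c : ℕ → ℕ) : Prop where
  coveringRadius_eq : coveringRadius C = ρ
  up : ∀ i < ρ, ∀ x ∈ layer C i,
    {y | hammingDist x y = 1 ∧ y ∈ layer C (i + 1)}.ncard = b i
  down : ∀ i, 1 ≤ i → i ≤ ρ → ∀ x ∈ layer C i,
    {y | hammingDist x y = 1 ∧ y ∈ layer C (i - 1)}.ncard = c i

/-- The vertices of the coset graph of `C`: the cosets `C + x`. -/
def Coset (C : Set (ι → ZMod 2)) : Type _ :=
  {D : Set (ι → ZMod 2) // ∃ x, D = (fun v => v + x) '' C}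

noncomputable instance (C : Set (ι → ZMod 2)) : Fintype (Coset C) :=
  Fintype.ofInjective (fun D : Coset C => D.1) Subtype.val_injective

/-- The coset graph of `C`: distinct cosets are adjacent when they contain vectors at Hamming
distance one. -/
def cosetGraph (C : Set (ι → ZMod 2)) : SimpleGraph (Coset C) where
  Adj D D' := D ≠ D' ∧ ∃ v ∈ D.1, ∃ v' ∈ D'.1, hammingDist v v' = 1
  symm := ⟨by
    rintro D D' ⟨hne, v, hv, v', hv', h⟩
    exact ⟨hne.symm, v', hv', v, hv, by rw [hammingDist_comm]; exact h⟩⟩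
  loopless := ⟨fun _ h => h.1 rfl⟩

end Codes

/-! ### The codes `C^{(m)}` and `C^{[m]}` -/

/-- The binary vectors of length `m` and weight `2`. -/
abbrev WeightTwo (m : ℕ) : Type :=
  {v : Fin m → ZMod 2 // hammingNorm v = 2}

/-- The matrix `H_m`, each vector of length `m` and weight `2` occurring once as a column. -/
def parityCheck (m : ℕ) : Matrix (Fin m) (WeightTwo m) (ZMod 2) :=
  Matrix.of fun i e => e.1 i

/-- The linear code `C^{(m)}` with parity check matrix `H_m`. -/
def codeRound (m : ℕ) : Submodule (ZMod 2) (WeightTwo m → ZMod 2) :=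
  LinearMap.ker (parityCheck m).mulVecLin

/-- The code `C^{[m]} = C^{(m)} ∪ C^{(m)}(ρ)`, where `ρ` is the covering radius of `C^{(m)}`. -/
def codeSquare (m : ℕ) : Set (WeightTwo m → ZMod 2) :=
  (codeRound m : Set (WeightTwo m → ZMod 2)) ∪
    layer (codeRound m : Set (WeightTwo m → ZMod 2))
      (coveringRadius (codeRound m : Set (WeightTwo m → ZMod 2)))

/-- The graph `Γ^{(m)}`. -/
abbrev graphRound (m : ℕ) : SimpleGraph (Coset (codeRound m : Set (WeightTwo m → ZMod 2))) :=
  cosetGraph (codeRound m : Set (WeightTwo m → ZMod 2))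

/-- The graph `Γ^{[m]}`. -/
abbrev graphSquare (m : ℕ) : SimpleGraph (Coset (codeSquare m)) :=
  cosetGraph (codeSquare m)

/-! ### Graphs -/

section Graphs

variable {V W : Type*}

/-- `G` is distance-regular of diameter `ρ` with intersection array
`(b 0, …, b (ρ - 1); c 1, …, c ρ)`. -/
structure IsDistanceRegularWith (G : SimpleGraph V) (ρ : ℕ) (b c : ℕ → ℕ) : Prop where
  connected : G.Connected
  diam_eq : G.diam = ρ
  regular : ∃ k : ℕ, ∀ v, (G.neighborSet v).ncard = k
  up : ∀ i < ρ, ∀ u v, G.dist u v = i →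
    {w | G.Adj v w ∧ G.dist u w = i + 1}.ncard = b i
  down : ∀ i, 1 ≤ i → i ≤ ρ → ∀ u v, G.dist u v = i →
    {w | G.Adj v w ∧ G.dist u w = i - 1}.ncard = c i

/-- A connected graph is distance-transitive if its automorphism group is transitive on the ordered
pairs of vertices at any given distance. -/
def IsDistanceTransitive (G : SimpleGraph V) : Prop :=
  G.Connected ∧ ∀ u v u' v', G.dist u v = G.dist u' v' → ∃ π : G ≃g G, π u = u' ∧ π v = v'

/-- The graph on the vertices of `G` whose edges are the pairs at distance `i` in `G`. -/
def distanceGraph (G : SimpleGraph V) (i : ℕ) : SimpleGraph V where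
  Adj u v := u ≠ v ∧ G.dist u v = i
  symm := ⟨fun _ _ h => ⟨h.1.symm, by rw [SimpleGraph.dist_comm]; exact h.2⟩⟩
  loopless := ⟨fun _ h => h.1 rfl⟩

/-- `G` is primitive: it is connected and so are its distance-`i` graphs for `1 ≤ i ≤ diam G`. A
graph is imprimitive if it is not primitive. -/
def IsPrimitive (G : SimpleGraph V) : Prop :=
  G.Connected ∧ ∀ i, 1 ≤ i → i ≤ G.diam → (distanceGraph G i).Connected

/-- The map `f` is a twofold covering of graphs: every fibre has two elements, and `f` maps the
neighbours of each vertex `v` bijectively onto the neighbours of `f v`. -/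
def IsDoubleCover (G : SimpleGraph V) (H : SimpleGraph W) (f : V → W) : Prop :=
  (∀ w, (f ⁻¹' {w}).ncard = 2) ∧ ∀ v, Set.BijOn f (G.neighborSet v) (H.neighborSet (f v))

/-- The set of eigenvalues of (the adjacency matrix of) a finite graph. -/
def eigenvalues [Fintype V] (G : SimpleGraph V) : Set ℝ :=
  {θ | Module.End.HasEigenvalue (Matrix.toLin' (G.adjMatrix ℝ)) θ}

end Graphs

/-! ### The intersection numbers -/

/-- `b_i = binom (m - 2i) 2`. -/
def arrB (m i : ℕ) : ℕ := (m - 2 * i).choose 2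

/-- `c_i = binom (2i) 2`, the numbers for `C^{(m)}`. -/
def arrC (i : ℕ) : ℕ := (2 * i).choose 2

/-- The numbers `c_i` for `C^{[m]}`: `binom (2i) 2`, except that `c_ρ = 2 * binom (2ρ) 2` for
`ρ = m / 4` when `4 ∣ m`. -/
def arrCSquare (m i : ℕ) : ℕ :=
  if m % 4 = 0 ∧ i = m / 4 then 2 * (2 * i).choose 2 else (2 * i).choose 2

end CosetCode

/-! The syndrome `x ↦ H_m x` reduces everything to weights in `𝔽₂^m`. Its image is the set of
even-weight vectors, and since every column has weight 2, the distance from `x` to `C^{(m)}` is half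
the weight of its syndrome (`distTo_codeRound`). Thus `Γ^{(m)}` is the halved `m`-cube. The farthest
vectors are those with all-one syndrome, so `C^{[m]}` is the preimage of `{0, 1}`, hence linear. Its
coset graph is the folded halved cube, where a syndrome of weight `w` is at distance `min(w, m - w)
/ 2`.

Both codes have minimum distance at least 3, so the neighbours of a coset correspond to the
coordinates, that is, to pairs in an `m`-set (`MinDistThree.adj_iff`). The intersection numbers
count pairs disjoint from, or contained in, the support of the syndrome. Translations and coordinate
permutations give distance-transitivity.

Pairs at distance `m/2` in `Γ^{(m)}` have complementary syndromes and never leave a fibre of the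
cover, whence imprimitivity. In `Γ^{[m]}` every edge is a composite of two steps of length `i`,
whence primitivity.

The eigenvectors come from the characters `χ_S` trivial on the all-one vector, i.e. with `|S|` even.
The eigenvalue is the sum of `χ_S` over the pairs, `binom m 2 - 2s(m - s)` with `s = |S|`. -/

namespace CosetCode

/-! ### Coset graphs of binary linear codes -/

section LinearCosetGraph

set_option linter.unusedSectionVars false

variable {ι : Type*} [Fintype ι] {C : Submodule (ZMod 2) (ι → ZMod 2)}

/-- The coset `C + x` of a linear code, as a vertex of its coset graph. -/
def cosetOf (C : Submodule (ZMod 2) (ι → ZMod 2)) (x : ι → ZMod 2) :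
    Coset (C : Set (ι → ZMod 2)) :=
  ⟨(fun v => v + x) '' (C : Set (ι → ZMod 2)), x, rfl⟩

lemma mem_cosetOf {x y : ι → ZMod 2} : y ∈ (cosetOf C x).1 ↔ y - x ∈ C := by
  constructor
  · rintro ⟨v, hv, rfl⟩
    simpa using hv
  · intro h
    exact ⟨y - x, h, by simp⟩

lemma cosetOf_eq_iff {x y : ι → ZMod 2} : cosetOf C x = cosetOf C y ↔ x - y ∈ C := by
  constructor
  · intro h
    rw [← mem_cosetOf, ← h, mem_cosetOf]
    simp
  · intro h
    apply Subtype.ext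
    ext z
    rw [mem_cosetOf, mem_cosetOf]
    constructor
    · intro hz
      simpa using C.add_mem hz h
    · intro hz
      simpa using C.sub_mem hz h

lemma cosetOf_surjective : Function.Surjective (cosetOf C) := by
  rintro ⟨_, x, rfl⟩
  exact ⟨x, rfl⟩

lemma hammingNorm_single [DecidableEq ι] (j : ι) : hammingNorm (Pi.single j 1 : ι → ZMod 2) = 1 := by
  rw [hammingNorm, Finset.card_eq_one]
  refine ⟨j, ?_⟩
  ext i
  by_cases h : i = j
  · subst h; simp
  · simp [h]

lemma hammingDist_eq_norm_sub (x y : ι → ZMod 2) : hammingDist x y = hammingNorm (x - y) := by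
  rw [hammingDist_comm, hammingDist_eq_hammingNorm, neg_add_eq_sub]

lemma hammingNorm_add_le (x y : ι → ZMod 2) :
    hammingNorm (x + y) ≤ hammingNorm x + hammingNorm y := by
  have h := hammingDist_triangle (x + y) y 0
  rw [hammingDist_zero_right, hammingDist_zero_right, hammingDist_eq_norm_sub,
    add_sub_cancel_right] at h
  omega

lemma zmod_two_eq_one {a : ZMod 2} (h : a ≠ 0) : a = 1 := by
  revert h; revert a; decide

lemma hammingDist_eq_one_iff [DecidableEq ι] {x y : ι → ZMod 2} :
    hammingDist x y = 1 ↔ ∃ j, y = x + Pi.single j 1 := by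
  constructor
  · intro h
    rw [hammingDist_comm, hammingDist_eq_norm_sub, hammingNorm, Finset.card_eq_one] at h
    obtain ⟨j, hj⟩ := h
    refine ⟨j, ?_⟩
    ext i
    have hi := Finset.ext_iff.1 hj i
    simp only [Pi.sub_apply, ne_eq, Finset.mem_filter, Finset.mem_univ, true_and,
      Finset.mem_singleton] at hi
    by_cases hij : i = j
    · subst hij
      have := zmod_two_eq_one (hi.2 rfl)
      simp [← this]
    · have : y i - x i = 0 := by
        by_contra h0
        exact hij (hi.1 h0)
      simp [hij, sub_eq_zero.1 this]
  · rintro ⟨j, rfl⟩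
    rw [hammingDist_comm, hammingDist_eq_norm_sub, add_sub_cancel_left, hammingNorm_single]

lemma exists_eq_add_single [DecidableEq ι] {z : ι → ZMod 2} (hz : z ≠ 0) :
    ∃ z' j, z = z' + Pi.single j 1 ∧ hammingNorm z = hammingNorm z' + 1 := by
  obtain ⟨j, hj⟩ := Function.ne_iff.1 hz
  refine ⟨z - (Pi.single j 1 : ι → ZMod 2), j, by simp, ?_⟩
  have h1 : z j = 1 := zmod_two_eq_one hj
  have : (Finset.univ.filter fun i => z i ≠ 0) =
      insert j (Finset.univ.filter fun i => (z - (Pi.single j 1 : ι → ZMod 2)) i ≠ 0) := by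
    ext i
    by_cases h : i = j
    · subst h; simp [h1]
    · simp [h]
  rw [hammingNorm, this, Finset.card_insert_of_notMem (by simp [h1]), hammingNorm]

lemma distTo_le {v c : ι → ZMod 2} (hc : c ∈ C) :
    distTo (C : Set (ι → ZMod 2)) v ≤ hammingNorm (v - c) :=
  Nat.sInf_le ⟨c, hc, hammingDist_eq_norm_sub v c⟩

lemma exists_distTo (C : Submodule (ZMod 2) (ι → ZMod 2)) (v : ι → ZMod 2) :
    ∃ c ∈ C, hammingNorm (v - c) = distTo (C : Set (ι → ZMod 2)) v := by
  have h : {d : ℕ | ∃ x ∈ (C : Set (ι → ZMod 2)), hammingDist v x = d}.Nonempty :=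
    ⟨_, 0, C.zero_mem, rfl⟩
  obtain ⟨c, hc, h⟩ := Nat.sInf_mem h
  exact ⟨c, hc, by rw [← hammingDist_eq_norm_sub]; exact h⟩

lemma distTo_neg (v : ι → ZMod 2) :
    distTo (C : Set (ι → ZMod 2)) (-v) = distTo (C : Set (ι → ZMod 2)) v := by
  congr 1
  ext i
  exact CharTwo.neg_eq (v i)

lemma cosetGraph_adj_add_single [DecidableEq ι] {x : ι → ZMod 2} {j : ι}
    (h : cosetOf C x ≠ cosetOf C (x + Pi.single j 1)) :
    (cosetGraph (C : Set (ι → ZMod 2))).Adj (cosetOf C x) (cosetOf C (x + Pi.single j 1)) :=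
  ⟨h, x, mem_cosetOf.2 (by simp), x + Pi.single j 1, mem_cosetOf.2 (by simp),
    hammingDist_eq_one_iff.2 ⟨j, rfl⟩⟩

/-- The ones of `z` are added one at a time. A step that stays inside its coset is dropped, so the
length is only bounded above. -/
lemma exists_walk_add [DecidableEq ι] (x z : ι → ZMod 2) :
    ∃ w : (cosetGraph (C : Set (ι → ZMod 2))).Walk (cosetOf C x) (cosetOf C (x + z)),
      w.length ≤ hammingNorm z := by
  induction hn : hammingNorm z generalizing z with
  | zero =>
    obtain rfl := hammingNorm_eq_zero.1 hn
    rw [add_zero]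
    exact ⟨.nil, by simp⟩
  | succ n ih =>
    obtain ⟨z', j, rfl, hz⟩ := exists_eq_add_single (z := z) (by rintro rfl; simp at hn)
    obtain ⟨w, hw⟩ := ih z' (by omega)
    by_cases h : cosetOf C (x + z') = cosetOf C (x + z' + Pi.single j 1)
    · rw [← add_assoc, ← h]
      exact ⟨w, by omega⟩
    · rw [← add_assoc]
      refine ⟨w.concat (cosetGraph_adj_add_single h), ?_⟩
      rw [SimpleGraph.Walk.length_concat]
      omega

/-- Each edge provides its own representatives. Translating by a codeword makes those of consecutive
edges agree, and the triangle inequality adds up. -/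
lemma exists_hammingDist_le_length {D D' : Coset (C : Set (ι → ZMod 2))}
    (w : (cosetGraph (C : Set (ι → ZMod 2))).Walk D D') :
    ∃ x ∈ D.1, ∃ y ∈ D'.1, hammingNorm (x - y) ≤ w.length := by
  induction w with
  | @nil D =>
    obtain ⟨x, rfl⟩ := cosetOf_surjective D
    exact ⟨x, mem_cosetOf.2 (by simp), x, mem_cosetOf.2 (by simp), by simp⟩
  | @cons D D₁ D' hadj w ih =>
    obtain ⟨-, v, hv, v', hv', h1⟩ := hadj
    obtain ⟨x, hx, y, hy, hxy⟩ := ih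
    obtain ⟨a, rfl⟩ := cosetOf_surjective D₁
    obtain ⟨b, rfl⟩ := cosetOf_surjective D'
    rw [mem_cosetOf] at hv' hx hy
    refine ⟨v, hv, y + (v' - x), mem_cosetOf.2 ?_, ?_⟩
    · have := C.add_mem hy (C.sub_mem hv' hx)
      convert this using 1
      abel
    · have h2 := hammingNorm_add_le (v - v') (x - y)
      rw [hammingDist_eq_norm_sub] at h1
      have h3 : v - (y + (v' - x)) = v - v' + (x - y) := by abel
      rw [h3]
      change _ ≤ w.length + 1
      omega

lemma cosetGraph_connected (C : Submodule (ZMod 2) (ι → ZMod 2)) :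
    (cosetGraph (C : Set (ι → ZMod 2))).Connected := by
  classical
  have : Nonempty (Coset (C : Set (ι → ZMod 2))) := ⟨cosetOf C 0⟩
  refine ⟨fun D D' => ?_⟩
  obtain ⟨x, rfl⟩ := cosetOf_surjective D
  obtain ⟨y, rfl⟩ := cosetOf_surjective D'
  obtain ⟨w, -⟩ := exists_walk_add (C := C) x (y - x)
  rw [add_sub_cancel] at w
  exact ⟨w⟩

lemma cosetGraph_dist (x y : ι → ZMod 2) :
    (cosetGraph (C : Set (ι → ZMod 2))).dist (cosetOf C x) (cosetOf C y) =
      distTo (C : Set (ι → ZMod 2)) (y - x) := by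
  classical
  apply le_antisymm
  · obtain ⟨c, hc, h⟩ := exists_distTo C (y - x)
    obtain ⟨w, hw⟩ := exists_walk_add (C := C) x (y - x - c)
    have hy : cosetOf C (x + (y - x - c)) = cosetOf C y := by
      rw [cosetOf_eq_iff]
      have : x + (y - x - c) - y = -c := by abel
      rw [this]
      exact C.neg_mem hc
    rw [← hy, ← h]
    exact (SimpleGraph.dist_le w).trans hw
  · obtain ⟨w, hw⟩ := (cosetGraph_connected C).exists_walk_length_eq_dist (cosetOf C x) (cosetOf C y)
    obtain ⟨a, ha, b, hb, h⟩ := exists_hammingDist_le_length w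
    rw [mem_cosetOf] at ha hb
    rw [← hw, ← distTo_neg, neg_sub]
    have h3 : (x - y) - ((b - y) - (a - x)) = a - b := by abel
    refine le_trans ?_ h
    rw [← h3]
    exact distTo_le (C.sub_mem hb ha)

/-- A linear code has minimum distance at least three. -/
def MinDistThree (C : Submodule (ZMod 2) (ι → ZMod 2)) : Prop :=
  ∀ c ∈ C, c ≠ 0 → 3 ≤ hammingNorm c

/-- Two unit vectors in the same coset would differ by a nonzero codeword of weight at most 2. -/
lemma MinDistThree.add_single_injective [DecidableEq ι] (hC : MinDistThree C) (x : ι → ZMod 2) :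
    Function.Injective fun j => cosetOf C (x + Pi.single j 1) := by
  intro j k h
  have h1 := cosetOf_eq_iff.1 h
  by_contra hjk
  have h2 : x + Pi.single j 1 - (x + Pi.single k 1) = Pi.single j (1 : ZMod 2) + Pi.single k 1 := by
    rw [add_sub_add_left_eq_sub]
    ext i
    exact CharTwo.sub_eq_add _ _
  rw [h2] at h1
  have h3 := hC _ h1 (by
    intro h0
    have := congrFun h0 j
    simp [hjk] at this)
  have h4 := hammingNorm_add_le (Pi.single j 1 : ι → ZMod 2) (Pi.single k 1)
  rw [hammingNorm_single, hammingNorm_single] at h4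
  omega

lemma MinDistThree.adj_iff [DecidableEq ι] (hC : MinDistThree C) {x : ι → ZMod 2}
    {D : Coset (C : Set (ι → ZMod 2))} :
    (cosetGraph (C : Set (ι → ZMod 2))).Adj (cosetOf C x) D ↔
      ∃ j, cosetOf C (x + Pi.single j 1) = D := by
  constructor
  · rintro ⟨-, v, hv, v', hv', h⟩
    obtain ⟨j, rfl⟩ := hammingDist_eq_one_iff.1 h
    obtain ⟨y, rfl⟩ := cosetOf_surjective D
    refine ⟨j, ?_⟩
    rw [mem_cosetOf] at hv hv'
    rw [cosetOf_eq_iff]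
    have := C.sub_mem hv' hv
    convert this using 1
    abel
  · rintro ⟨j, rfl⟩
    apply cosetGraph_adj_add_single
    intro h
    have h1 := cosetOf_eq_iff.1 h.symm
    rw [add_sub_cancel_left] at h1
    have := hC _ h1 (by simp)
    rw [hammingNorm_single] at this
    omega

/-- Together with `ncard_hammingDist_one`, this turns the counts for the graph and for the code into
the same count of coordinates. -/
lemma MinDistThree.ncard_adj [DecidableEq ι] (hC : MinDistThree C) (x : ι → ZMod 2)
    (P : Coset (C : Set (ι → ZMod 2)) → Prop) :
    {D | (cosetGraph (C : Set (ι → ZMod 2))).Adj (cosetOf C x) D ∧ P D}.ncard =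
      {j | P (cosetOf C (x + Pi.single j 1))}.ncard := by
  rw [← Set.ncard_image_of_injective _ (hC.add_single_injective x)]
  congr 1
  ext D
  simp only [Set.mem_ofPred_eq, hC.adj_iff, Set.mem_image]
  constructor
  · rintro ⟨⟨j, rfl⟩, h⟩
    exact ⟨j, h, rfl⟩
  · rintro ⟨j, h, rfl⟩
    exact ⟨⟨j, rfl⟩, h⟩

lemma ncard_hammingDist_one [DecidableEq ι] (x : ι → ZMod 2) (P : (ι → ZMod 2) → Prop) :
    {y | hammingDist x y = 1 ∧ P y}.ncard = {j | P (x + Pi.single j 1)}.ncard := by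
  have hinj : Function.Injective fun j => x + Pi.single j (1 : ZMod 2) := by
    intro j k h
    have h1 := congrFun (add_left_cancel h) j
    by_contra hjk
    simp [hjk] at h1
  rw [← Set.ncard_image_of_injective _ hinj]
  congr 1
  ext D
  simp only [Set.mem_ofPred_eq, hammingDist_eq_one_iff, Set.mem_image]
  constructor
  · rintro ⟨⟨j, rfl⟩, h⟩
    exact ⟨j, h, rfl⟩
  · rintro ⟨j, h, rfl⟩
    exact ⟨⟨j, rfl⟩, h⟩

/-- If the numbers of coordinates moving a vector one layer up or down depend only on the layer,
then both the code is completely regular and its coset graph is distance-regular. -/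
lemma MinDistThree.regular_of_count [DecidableEq ι] (hC : MinDistThree C) {ρ : ℕ} {b c : ℕ → ℕ}
    (hle : ∀ x, distTo (C : Set (ι → ZMod 2)) x ≤ ρ)
    (hex : ∃ x, distTo (C : Set (ι → ZMod 2)) x = ρ)
    (hup : ∀ i < ρ, ∀ x, distTo (C : Set (ι → ZMod 2)) x = i →
      {j | distTo (C : Set (ι → ZMod 2)) (x + Pi.single j 1) = i + 1}.ncard = b i)
    (hdown : ∀ i, 1 ≤ i → i ≤ ρ → ∀ x, distTo (C : Set (ι → ZMod 2)) x = i →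
      {j | distTo (C : Set (ι → ZMod 2)) (x + Pi.single j 1) = i - 1}.ncard = c i) :
    IsCompletelyRegularWith (C : Set (ι → ZMod 2)) ρ b c ∧
      IsDistanceRegularWith (cosetGraph (C : Set (ι → ZMod 2))) ρ b c := by
  obtain ⟨x₀, hx₀⟩ := hex
  refine ⟨⟨?_, ?_, ?_⟩, ⟨cosetGraph_connected C, ?_, ?_, ?_, ?_⟩⟩
  · apply le_antisymm
    · exact Finset.sup_le fun x _ => hle x
    · rw [← hx₀]
      exact Finset.le_sup (f := distTo (C : Set (ι → ZMod 2))) (@Finset.mem_univ _ (_) x₀)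
  · intro i hi x hx
    rw [ncard_hammingDist_one]
    exact hup i hi x hx
  · intro i h1 hi x hx
    rw [ncard_hammingDist_one]
    exact hdown i h1 hi x hx
  · have : Nonempty (Coset (C : Set (ι → ZMod 2))) := ⟨cosetOf C 0⟩
    apply le_antisymm
    · obtain ⟨u, v, h⟩ := (cosetGraph (C : Set (ι → ZMod 2))).exists_dist_eq_diam
      obtain ⟨x, rfl⟩ := cosetOf_surjective u
      obtain ⟨y, rfl⟩ := cosetOf_surjective v
      rw [← h, cosetGraph_dist]
      exact hle _
    · have h : (cosetGraph (C : Set (ι → ZMod 2))).dist (cosetOf C 0) (cosetOf C x₀) ≤ _ :=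
        SimpleGraph.dist_le_diam
          (SimpleGraph.connected_iff_ediam_ne_top.1 (cosetGraph_connected C))
      rwa [cosetGraph_dist, sub_zero, hx₀] at h
  · refine ⟨(Set.univ : Set ι).ncard, fun v => ?_⟩
    obtain ⟨x, rfl⟩ := cosetOf_surjective v
    have := hC.ncard_adj x fun _ => True
    simpa [SimpleGraph.neighborSet] using this
  · intro i hi u v h
    obtain ⟨x, rfl⟩ := cosetOf_surjective u
    obtain ⟨y, rfl⟩ := cosetOf_surjective v
    rw [cosetGraph_dist] at h
    rw [hC.ncard_adj, ← hup i hi _ h]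
    simp only [cosetGraph_dist, sub_add_eq_add_sub]
  · intro i h1 hi u v h
    obtain ⟨x, rfl⟩ := cosetOf_surjective u
    obtain ⟨y, rfl⟩ := cosetOf_surjective v
    rw [cosetGraph_dist] at h
    rw [hC.ncard_adj, ← hdown i h1 hi _ h]
    simp only [cosetGraph_dist, sub_add_eq_add_sub]

/-- A Hamming isometry of the ambient space permuting the cosets of `C` induces an automorphism of
the coset graph. -/
lemma exists_cosetGraph_iso (g : (ι → ZMod 2) ≃ (ι → ZMod 2))
    (hg : ∀ x y, hammingDist (g x) (g y) = hammingDist x y)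
    (hgC : ∀ x y, g x - g y ∈ C ↔ x - y ∈ C) :
    ∃ π : cosetGraph (C : Set (ι → ZMod 2)) ≃g cosetGraph (C : Set (ι → ZMod 2)),
      ∀ x, π (cosetOf C x) = cosetOf C (g x) := by
  have key : ∀ (h : (ι → ZMod 2) ≃ (ι → ZMod 2)), (∀ x y, h x - h y ∈ C ↔ x - y ∈ C) →
      ∀ x, h '' (cosetOf C x).1 = (cosetOf C (h x)).1 := by
    intro h hh x
    ext z
    simp only [Set.mem_image, mem_cosetOf]
    constructor
    · rintro ⟨y, hy, rfl⟩
      exact (hh _ _).2 hy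
    · intro hz
      exact ⟨h.symm z, by rwa [← hh, h.apply_symm_apply], h.apply_symm_apply z⟩
  have hgC' : ∀ x y, g.symm x - g.symm y ∈ C ↔ x - y ∈ C := by
    intro x y
    rw [← hgC, g.apply_symm_apply, g.apply_symm_apply]
  have stable : ∀ (h : (ι → ZMod 2) ≃ (ι → ZMod 2)), (∀ x y, h x - h y ∈ C ↔ x - y ∈ C) →
      ∀ D : Coset (C : Set (ι → ZMod 2)),
        ∃ x, h '' D.1 = (fun v => v + x) '' (C : Set (ι → ZMod 2)) := by
    intro h hh D
    obtain ⟨x, rfl⟩ := cosetOf_surjective D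
    exact ⟨h x, key h hh x⟩
  let e : Coset (C : Set (ι → ZMod 2)) ≃ Coset (C : Set (ι → ZMod 2)) :=
    { toFun := fun D => ⟨g '' D.1, stable g hgC D⟩
      invFun := fun D => ⟨g.symm '' D.1, stable g.symm hgC' D⟩
      left_inv := fun D => Subtype.ext (g.symm_image_image D.1)
      right_inv := fun D => Subtype.ext (g.image_symm_image D.1) }
  refine ⟨⟨e, ?_⟩, fun x => Subtype.ext (key g hgC x)⟩
  intro D D'
  change (e D ≠ e D' ∧ ∃ v ∈ g '' D.1, ∃ v' ∈ g '' D'.1, hammingDist v v' = 1) ↔ _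
  rw [e.injective.ne_iff]
  simp only [Set.exists_mem_image, hg]
  exact Iff.rfl

end LinearCosetGraph

/-! ### Weights of binary vectors and counts of pairs -/

section Weights

variable {m : ℕ}

/-- The support of a binary vector. -/
def supp (v : Fin m → ZMod 2) : Finset (Fin m) := Finset.univ.filter fun i => v i ≠ 0

/-- The characteristic vector of a set of coordinates. -/
def charVec (S : Finset (Fin m)) : Fin m → ZMod 2 := fun i => if i ∈ S then 1 else 0

lemma mem_supp {v : Fin m → ZMod 2} {i : Fin m} : i ∈ supp v ↔ v i ≠ 0 := by simp [supp]

lemma card_supp (v : Fin m → ZMod 2) : (supp v).card = hammingNorm v := rfl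

lemma supp_charVec (S : Finset (Fin m)) : supp (charVec S) = S := by
  ext i
  simp [mem_supp, charVec]

lemma charVec_supp (v : Fin m → ZMod 2) : charVec (supp v) = v := by
  ext i
  by_cases h : v i = 0
  · simp [mem_supp, charVec, h]
  · simp [mem_supp, charVec, zmod_two_eq_one h]

lemma hammingNorm_charVec (S : Finset (Fin m)) : hammingNorm (charVec S) = S.card := by
  rw [← card_supp, supp_charVec]

lemma supp_add (u v : Fin m → ZMod 2) : supp (u + v) = symmDiff (supp u) (supp v) := by
  ext i
  simp only [mem_supp, Finset.mem_symmDiff, Pi.add_apply]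
  generalize u i = a
  generalize v i = b
  revert a b
  decide

lemma hammingNorm_add_inter (u v : Fin m → ZMod 2) :
    hammingNorm (u + v) + 2 * (supp u ∩ supp v).card = hammingNorm u + hammingNorm v := by
  have h := Finset.card_sdiff_add_card_inter (supp u) (supp v)
  have h' := Finset.card_sdiff_add_card_inter (supp v) (supp u)
  rw [Finset.inter_comm] at h'
  rw [← card_supp, ← card_supp, ← card_supp, supp_add, symmDiff, Finset.sup_eq_union,
    Finset.card_union_of_disjoint disjoint_sdiff_sdiff]
  omega

lemma hammingNorm_le (v : Fin m → ZMod 2) : hammingNorm v ≤ m := by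
  simpa using hammingNorm_le_card_fintype (x := v)

lemma supp_add_one (v : Fin m → ZMod 2) : supp (v + 1) = (supp v)ᶜ := by
  ext i
  simp only [mem_supp, Finset.mem_compl, Pi.add_apply, Pi.one_apply]
  generalize v i = a
  revert a
  decide

lemma hammingNorm_add_one (v : Fin m → ZMod 2) : hammingNorm (v + 1) = m - hammingNorm v := by
  rw [← card_supp, supp_add_one, Finset.card_compl, Fintype.card_fin, card_supp]

lemma hammingNorm_one : hammingNorm (1 : Fin m → ZMod 2) = m := by
  simpa using hammingNorm_add_one (0 : Fin m → ZMod 2)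

lemma eq_one_of_hammingNorm {v : Fin m → ZMod 2} (h : hammingNorm v = m) : v = 1 := by
  have : supp v = Finset.univ := by
    rw [← Finset.card_eq_iff_eq_univ, card_supp, h, Fintype.card_fin]
  rw [← charVec_supp v, this]
  ext i
  simp [charVec]

lemma add_self_eq_zero (v : Fin m → ZMod 2) : v + v = 0 := by
  ext i
  exact CharTwo.add_self_eq_zero _

lemma sub_eq_add_vec {ι : Type*} (u v : ι → ZMod 2) : u - v = u + v := by
  ext i
  exact CharTwo.sub_eq_add _ _

/-- The vector of weight two supported on a pair. -/
def pairVec (S : Finset (Fin m)) (hS : S.card = 2) : WeightTwo m :=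
  ⟨charVec S, by rw [hammingNorm_charVec, hS]⟩

lemma ncard_supp_subset (S : Finset (Fin m)) :
    {e : WeightTwo m | supp e.1 ⊆ S}.ncard = S.card.choose 2 := by
  rw [← Finset.card_powersetCard, ← Set.ncard_coe_finset]
  refine Set.ncard_congr (fun e _ => supp e.1) ?_ ?_ ?_
  · intro e he
    exact Finset.mem_coe.2 (Finset.mem_powersetCard.2 ⟨he, e.2⟩)
  · intro e f _ _ h
    apply Subtype.ext
    rw [← charVec_supp e.1, ← charVec_supp f.1]
    exact congrArg charVec h
  · intro T hT
    obtain ⟨h1, h2⟩ := Finset.mem_powersetCard.1 (Finset.mem_coe.1 hT)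
    exact ⟨pairVec T h2, by simpa [pairVec, supp_charVec] using h1,
      by simp [pairVec, supp_charVec]⟩

/-- The weight changes by `+2`, `0` or `-2` as the pair meets the support in 0, 1 or 2 points. All
later case distinctions rest on this. -/
lemma hammingNorm_add_weightTwo (v : Fin m → ZMod 2) (e : WeightTwo m) :
    hammingNorm (v + e.1) + 2 * (supp v ∩ supp e.1).card = hammingNorm v + 2 ∧
      (supp v ∩ supp e.1).card ≤ 2 := by
  refine ⟨by rw [hammingNorm_add_inter, e.2], ?_⟩
  exact (Finset.card_le_card Finset.inter_subset_right).trans e.2.le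

lemma card_inter_eq_zero_iff (v : Fin m → ZMod 2) (e : WeightTwo m) :
    (supp v ∩ supp e.1).card = 0 ↔ supp e.1 ⊆ (supp v)ᶜ := by
  rw [Finset.card_eq_zero, ← Finset.disjoint_iff_inter_eq_empty, Finset.subset_compl_iff_disjoint_left]

lemma card_inter_eq_two_iff (v : Fin m → ZMod 2) (e : WeightTwo m) :
    (supp v ∩ supp e.1).card = 2 ↔ supp e.1 ⊆ supp v := by
  rw [← Finset.inter_eq_right]
  constructor
  · intro h
    exact Finset.eq_of_subset_of_card_le Finset.inter_subset_right (by rw [h, card_supp, e.2])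
  · intro h
    rw [h, card_supp, e.2]

lemma ncard_weight_up (v : Fin m → ZMod 2) :
    {e : WeightTwo m | hammingNorm (v + e.1) = hammingNorm v + 2}.ncard =
      (m - hammingNorm v).choose 2 := by
  have h : (supp v)ᶜ.card = m - hammingNorm v := by
    rw [Finset.card_compl, Fintype.card_fin, card_supp]
  rw [← h, ← ncard_supp_subset]
  congr 1
  ext e
  rw [Set.mem_ofPred_eq, Set.mem_ofPred_eq, ← card_inter_eq_zero_iff]
  have := hammingNorm_add_weightTwo v e
  omega

lemma ncard_weight_down (v : Fin m → ZMod 2) :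
    {e : WeightTwo m | hammingNorm (v + e.1) + 2 = hammingNorm v}.ncard =
      (hammingNorm v).choose 2 := by
  rw [← card_supp v, ← ncard_supp_subset]
  congr 1
  ext e
  rw [Set.mem_ofPred_eq, Set.mem_ofPred_eq, ← card_inter_eq_two_iff, card_supp]
  have := hammingNorm_add_weightTwo v e
  omega

end Weights

/-! ### Distances and intersection numbers through the syndrome -/

section Syndrome

variable {m : ℕ}

/-- The syndrome map of the parity check matrix `H_m`. -/
noncomputable def syndrome (m : ℕ) : (WeightTwo m → ZMod 2) →ₗ[ZMod 2] (Fin m → ZMod 2) :=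
  (parityCheck m).mulVecLin

lemma syndrome_single (e : WeightTwo m) : syndrome m (Pi.single e 1) = e.1 := by
  ext i
  simp [syndrome, parityCheck]

lemma mem_codeRound {x : WeightTwo m → ZMod 2} : x ∈ codeRound m ↔ syndrome m x = 0 := Iff.rfl

lemma sum_eq_hammingNorm (v : Fin m → ZMod 2) : ∑ i, v i = (hammingNorm v : ZMod 2) := by
  have : (hammingNorm v : ZMod 2) = ∑ i, if v i ≠ 0 then 1 else 0 := by
    rw [hammingNorm, Finset.card_filter]
    push_cast
    rfl
  rw [this]
  refine Finset.sum_congr rfl fun i _ => ?_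
  by_cases h : v i = 0
  · simp [h]
  · simp [zmod_two_eq_one h]

lemma even_hammingNorm_iff (v : Fin m → ZMod 2) : Even (hammingNorm v) ↔ ∑ i, v i = 0 := by
  rw [sum_eq_hammingNorm, ZMod.natCast_eq_zero_iff_even]

lemma even_hammingNorm_add {u v : Fin m → ZMod 2} (hu : Even (hammingNorm u)) :
    Even (hammingNorm (u + v)) ↔ Even (hammingNorm v) := by
  rw [even_hammingNorm_iff] at *
  rw [even_hammingNorm_iff]
  simp [Finset.sum_add_distrib, hu]

lemma even_hammingNorm_weightTwo (e : WeightTwo m) : Even (hammingNorm e.1) := by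
  rw [e.2]
  exact even_two

lemma hammingNorm_syndrome (x : WeightTwo m → ZMod 2) :
    Even (hammingNorm (syndrome m x)) ∧ hammingNorm (syndrome m x) ≤ 2 * hammingNorm x := by
  induction hn : hammingNorm x generalizing x with
  | zero =>
    obtain rfl := hammingNorm_eq_zero.1 hn
    simp
  | succ n ih =>
    obtain ⟨z, e, rfl, hz⟩ := exists_eq_add_single (z := x) (by rintro rfl; simp at hn)
    have h := ih z (by omega)
    rw [map_add, syndrome_single]
    refine ⟨(even_hammingNorm_add h.1).2 (even_hammingNorm_weightTwo e), ?_⟩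
    have := hammingNorm_add_le (syndrome m z) e.1
    rw [e.2] at this
    omega

/-- The support splits into pairs, each of which is a column of `H_m`. -/
lemma exists_syndrome_eq {v : Fin m → ZMod 2} (hv : Even (hammingNorm v)) :
    ∃ x, syndrome m x = v ∧ hammingNorm x ≤ hammingNorm v / 2 := by
  obtain ⟨d, hd⟩ := hv
  induction d generalizing v with
  | zero =>
    obtain rfl := hammingNorm_eq_zero.1 hd
    exact ⟨0, by simp⟩
  | succ d ih =>
    obtain ⟨T, hT, hT2⟩ := Finset.exists_subset_card_eq (s := supp v) (n := 2)
      (by rw [card_supp]; omega)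
    let e := pairVec T hT2
    have he : supp e.1 = T := supp_charVec T
    have h := hammingNorm_add_weightTwo v e
    have h2 := (card_inter_eq_two_iff v e).2 (by rw [he]; exact hT)
    obtain ⟨x, hx, hxn⟩ := ih (v := v + e.1) (by omega)
    refine ⟨x + Pi.single e 1, ?_, ?_⟩
    · rw [map_add, hx, syndrome_single, add_assoc, add_self_eq_zero, add_zero]
    · have := hammingNorm_add_le x (Pi.single e 1)
      rw [hammingNorm_single] at this
      omega

/-- The columns of `H_m` are nonzero and pairwise distinct. -/
lemma three_le_hammingNorm_of_syndrome_eq_zero {x : WeightTwo m → ZMod 2} (h0 : x ≠ 0)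
    (hx : syndrome m x = 0) : 3 ≤ hammingNorm x := by
  by_contra! hlt
  obtain ⟨y, e, rfl, hy⟩ := exists_eq_add_single h0
  rw [map_add, syndrome_single] at hx
  by_cases hy0 : y = 0
  · subst hy0
    have h2 := e.2
    rw [map_zero, zero_add] at hx
    rw [hx, hammingNorm_zero] at h2
    omega
  · obtain ⟨z, f, rfl, hz⟩ := exists_eq_add_single hy0
    obtain rfl := hammingNorm_eq_zero.1 (show hammingNorm z = 0 by omega)
    rw [zero_add] at h0 hx
    rw [syndrome_single, ← sub_eq_add_vec, sub_eq_zero] at hx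
    obtain rfl := Subtype.ext hx
    rw [← sub_eq_add_vec, sub_self] at h0
    exact h0 rfl

lemma codeRound_minDist (m : ℕ) : MinDistThree (codeRound m) := fun _ hc h0 =>
  three_le_hammingNorm_of_syndrome_eq_zero h0 (mem_codeRound.1 hc)

lemma distTo_codeRound (x : WeightTwo m → ZMod 2) :
    distTo (codeRound m : Set (WeightTwo m → ZMod 2)) x = hammingNorm (syndrome m x) / 2 := by
  apply le_antisymm
  · obtain ⟨z, hz, hn⟩ := exists_syndrome_eq (hammingNorm_syndrome x).1
    refine le_trans ?_ hn
    have hc : x - z ∈ codeRound m := by rw [mem_codeRound, map_sub, hz, sub_self]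
    have := distTo_le (v := x) hc
    rwa [sub_sub_cancel] at this
  · obtain ⟨c, hc, h⟩ := exists_distTo (codeRound m) x
    have h1 := (hammingNorm_syndrome (x - c)).2
    rw [map_sub, mem_codeRound.1 hc, sub_zero, h] at h1
    omega

/-- The code of all vectors with constant syndrome. -/
noncomputable def constantSyndromeCode (m : ℕ) : Submodule (ZMod 2) (WeightTwo m → ZMod 2) :=
  (Submodule.span (ZMod 2) {(1 : Fin m → ZMod 2)}).comap (syndrome m)

lemma mem_constantSyndromeCode {x : WeightTwo m → ZMod 2} :
    x ∈ constantSyndromeCode m ↔ syndrome m x = 0 ∨ syndrome m x = 1 := by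
  rw [constantSyndromeCode, Submodule.mem_comap, Submodule.mem_span_singleton]
  constructor
  · rintro ⟨a, ha⟩
    rw [← ha]
    by_cases h : a = 0
    · simp [h]
    · simp [zmod_two_eq_one h]
  · rintro (h | h)
    · exact ⟨0, by simp [h]⟩
    · exact ⟨1, by simp [h]⟩

/-- Reaching the all-one syndrome takes at least `m / 2` columns; this is where `6 ≤ m` is needed.
-/
lemma constantSyndromeCode_minDist (hm : 6 ≤ m) : MinDistThree (constantSyndromeCode m) := by
  intro c hc h0
  rcases mem_constantSyndromeCode.1 hc with h | h
  · exact three_le_hammingNorm_of_syndrome_eq_zero h0 h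
  · have := (hammingNorm_syndrome c).2
    rw [h, hammingNorm_one] at this
    omega

/-- The distance of a vector of syndrome `v` from the code of vectors with constant syndrome. -/
def foldedWeight (v : Fin m → ZMod 2) : ℕ := min (hammingNorm v) (m - hammingNorm v) / 2

lemma foldedWeight_add_one (v : Fin m → ZMod 2) : foldedWeight (v + 1) = foldedWeight v := by
  have := hammingNorm_le v
  rw [foldedWeight, foldedWeight, hammingNorm_add_one]
  congr 1
  omega

lemma distTo_constantSyndromeCode (hev : Even m) (x : WeightTwo m → ZMod 2) :
    distTo (constantSyndromeCode m : Set (WeightTwo m → ZMod 2)) x =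
      foldedWeight (syndrome m x) := by
  have hx := (hammingNorm_syndrome x).1
  apply le_antisymm
  -- Modulo the code, `x` may be corrected either to its own syndrome or to the complement,
  -- whichever is lighter.
  · have key : ∀ v, Even (hammingNorm v) → (syndrome m x = v ∨ syndrome m x = v + 1) →
        distTo (constantSyndromeCode m : Set (WeightTwo m → ZMod 2)) x ≤ hammingNorm v / 2 := by
      intro v hv h
      obtain ⟨z, hz, hn⟩ := exists_syndrome_eq hv
      refine le_trans ?_ hn
      have hc : x - z ∈ constantSyndromeCode m := by
        rw [mem_constantSyndromeCode, map_sub, hz]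
        rcases h with h | h
        · left; rw [h, sub_self]
        · right; rw [h, add_sub_cancel_left]
      have := distTo_le (v := x) hc
      rwa [sub_sub_cancel] at this
    have h1 := key _ hx (.inl rfl)
    have h2 := key (syndrome m x + 1)
      ((even_hammingNorm_add hx).2 (by rwa [hammingNorm_one]))
      (.inr (by rw [add_assoc, add_self_eq_zero, add_zero]))
    rw [hammingNorm_add_one] at h2
    unfold foldedWeight
    omega
  · obtain ⟨c, hc, h⟩ := exists_distTo (constantSyndromeCode m) x
    have h1 := (hammingNorm_syndrome (x - c)).2
    rw [h, map_sub] at h1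
    rw [foldedWeight]
    rcases mem_constantSyndromeCode.1 hc with h0 | h0
    · rw [h0, sub_zero] at h1
      omega
    · rw [h0, sub_eq_add_vec, hammingNorm_add_one] at h1
      omega

lemma exists_weight {k : ℕ} (hk : k ≤ m) : ∃ v : Fin m → ZMod 2, hammingNorm v = k := by
  obtain ⟨S, -, hS⟩ := Finset.exists_subset_card_eq (s := (Finset.univ : Finset (Fin m))) (n := k)
    (by simpa using hk)
  exact ⟨charVec S, by rw [hammingNorm_charVec, hS]⟩

theorem codeRound_regular (hev : Even m) :
    IsCompletelyRegularWith (codeRound m : Set (WeightTwo m → ZMod 2)) (m / 2) (arrB m) arrC ∧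
      IsDistanceRegularWith (graphRound m) (m / 2) (arrB m) arrC := by
  obtain ⟨n, hn⟩ := hev
  refine (codeRound_minDist m).regular_of_count ?_ ?_ ?_ ?_
  · intro x
    have := hammingNorm_le (syndrome m x)
    rw [distTo_codeRound]
    omega
  · obtain ⟨x, hx, -⟩ := exists_syndrome_eq (v := (1 : Fin m → ZMod 2))
      (by rw [hammingNorm_one]; exact ⟨n, hn⟩)
    exact ⟨x, by rw [distTo_codeRound, hx, hammingNorm_one]⟩
  · intro i hi x hx
    obtain ⟨d, hd⟩ := (hammingNorm_syndrome x).1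
    rw [distTo_codeRound] at hx
    have h2 : hammingNorm (syndrome m x) = 2 * i := by omega
    rw [arrB, ← h2, ← ncard_weight_up]
    congr 1
    ext e
    rw [Set.mem_ofPred_eq, Set.mem_ofPred_eq, distTo_codeRound, map_add, syndrome_single]
    have := hammingNorm_add_weightTwo (syndrome m x) e
    omega
  · intro i h1 hi x hx
    obtain ⟨d, hd⟩ := (hammingNorm_syndrome x).1
    rw [distTo_codeRound] at hx
    have h2 : hammingNorm (syndrome m x) = 2 * i := by omega
    rw [arrC, ← h2, ← ncard_weight_down]
    congr 1
    ext e
    rw [Set.mem_ofPred_eq, Set.mem_ofPred_eq, distTo_codeRound, map_add, syndrome_single]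
    have := hammingNorm_add_weightTwo (syndrome m x) e
    omega

lemma coveringRadius_codeRound (hev : Even m) :
    coveringRadius (codeRound m : Set (WeightTwo m → ZMod 2)) = m / 2 :=
  (codeRound_regular hev).1.coveringRadius_eq

/-- The last layer consists of the vectors whose syndrome has full weight `m`, and only the all-one
vector has it. -/
lemma coe_constantSyndromeCode (hev : Even m) :
    (constantSyndromeCode m : Set (WeightTwo m → ZMod 2)) = codeSquare m := by
  ext x
  rw [SetLike.mem_coe, mem_constantSyndromeCode, codeSquare, coveringRadius_codeRound hev]
  refine or_congr Iff.rfl ?_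
  rw [layer, Set.mem_ofPred_eq, distTo_codeRound]
  obtain ⟨d, hd⟩ := (hammingNorm_syndrome x).1
  obtain ⟨n, hn⟩ := hev
  constructor
  · intro h
    rw [h, hammingNorm_one]
  · intro h
    exact eq_one_of_hammingNorm (by omega)

/-- Here `2i + 2 ≤ m / 2`, so every weight reached lies in the lower half and folding changes
nothing. -/
lemma ncard_foldedWeight_up {v : Fin m → ZMod 2} {i : ℕ} (hi : i < m / 4)
    (hv : hammingNorm v = 2 * i) :
    {e : WeightTwo m | foldedWeight (v + e.1) = i + 1}.ncard = arrB m i := by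
  rw [arrB, ← hv, ← ncard_weight_up]
  congr 1
  ext e
  have := hammingNorm_add_weightTwo v e
  rw [Set.mem_ofPred_eq, Set.mem_ofPred_eq, foldedWeight]
  omega

lemma ncard_foldedWeight_down (hev : Even m) {v : Fin m → ZMod 2} {i : ℕ} (h1 : 1 ≤ i)
    (hi : i ≤ m / 4) (hv : hammingNorm v = 2 * i) :
    {e : WeightTwo m | foldedWeight (v + e.1) = i - 1}.ncard = arrCSquare m i := by
  obtain ⟨n, hn⟩ := hev
  rw [arrCSquare]
  split_ifs with h
  -- Now `m = 4i` and `v` has weight exactly `m / 2`: raising and lowering the weight both bring it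
  -- closer to the code, which doubles the count.
  · have hmv : m - hammingNorm v = 2 * i := by omega
    have hu := ncard_weight_up v
    have hd := ncard_weight_down v
    rw [hmv] at hu
    rw [hv] at hd
    rw [two_mul ((2 * i).choose 2)]
    nth_rewrite 1 [← hu]
    rw [← hd, ← Set.ncard_union_eq]
    · congr 1
      ext e
      have := hammingNorm_add_weightTwo v e
      simp only [Set.mem_union, Set.mem_ofPred_eq, foldedWeight]
      omega
    · rw [Set.disjoint_left]
      intro e he he'
      simp only [Set.mem_ofPred_eq] at he he'
      omega
  · rw [← hv, ← ncard_weight_down]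
    congr 1
    ext e
    have := hammingNorm_add_weightTwo v e
    rw [Set.mem_ofPred_eq, Set.mem_ofPred_eq, foldedWeight]
    omega

/-- A vector or its complement has weight twice the folded weight. -/
lemma exists_add_one_of_foldedWeight (hev : Even m) {v : Fin m → ZMod 2} {i : ℕ}
    (hv : Even (hammingNorm v)) (h : foldedWeight v = i) :
    hammingNorm v = 2 * i ∨ hammingNorm (v + 1) = 2 * i := by
  obtain ⟨n, hn⟩ := hev
  obtain ⟨d, hd⟩ := hv
  have := hammingNorm_le v
  rw [hammingNorm_add_one]
  unfold foldedWeight at h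
  omega

lemma foldedWeight_le (v : Fin m → ZMod 2) : foldedWeight v ≤ m / 4 := by
  unfold foldedWeight
  omega

theorem constantSyndromeCode_regular (hm : 6 ≤ m) (hev : Even m) :
    IsCompletelyRegularWith (constantSyndromeCode m : Set (WeightTwo m → ZMod 2)) (m / 4)
        (arrB m) (arrCSquare m) ∧
      IsDistanceRegularWith (cosetGraph (constantSyndromeCode m : Set (WeightTwo m → ZMod 2)))
        (m / 4) (arrB m) (arrCSquare m) := by
  -- Replacing a syndrome by its complement changes no folded weight, so the syndrome may be assumed
  -- to have weight `2i`.
  have shift : ∀ (v : Fin m → ZMod 2) (k : ℕ), {e : WeightTwo m | foldedWeight (v + e.1) = k} =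
      {e : WeightTwo m | foldedWeight (v + 1 + e.1) = k} := by
    intro v k
    ext e
    rw [Set.mem_ofPred_eq, Set.mem_ofPred_eq, add_right_comm, foldedWeight_add_one]
  refine (constantSyndromeCode_minDist hm).regular_of_count ?_ ?_ ?_ ?_
  · intro x
    rw [distTo_constantSyndromeCode hev]
    exact foldedWeight_le _
  · obtain ⟨v, hv⟩ := exists_weight (m := m) (k := 2 * (m / 4)) (by omega)
    obtain ⟨x, hx, -⟩ := exists_syndrome_eq (v := v) (by rw [hv]; exact even_two_mul _)
    refine ⟨x, ?_⟩
    rw [distTo_constantSyndromeCode hev, hx, foldedWeight, hv]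
    obtain ⟨n, hn⟩ := hev
    omega
  · intro i hi x hx
    rw [distTo_constantSyndromeCode hev] at hx
    simp only [distTo_constantSyndromeCode hev, map_add, syndrome_single]
    rcases exists_add_one_of_foldedWeight hev (hammingNorm_syndrome x).1 hx with h | h
    · exact ncard_foldedWeight_up hi h
    · rw [shift]
      exact ncard_foldedWeight_up hi h
  · intro i h1 hi x hx
    rw [distTo_constantSyndromeCode hev] at hx
    simp only [distTo_constantSyndromeCode hev, map_add, syndrome_single]
    rcases exists_add_one_of_foldedWeight hev (hammingNorm_syndrome x).1 hx with h | h
    · exact ncard_foldedWeight_down hev h1 hi h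
    · rw [shift]
      exact ncard_foldedWeight_down hev h1 hi h

end Syndrome

/-! ### The double cover -/

section Cover

variable {m : ℕ}

lemma codeRound_le_constantSyndromeCode : codeRound m ≤ constantSyndromeCode m := fun _ hx =>
  mem_constantSyndromeCode.2 (.inl (mem_codeRound.1 hx))

/-- The map sending a coset of `C^{(m)}` to the coset of vectors with constant syndrome
containing it. -/
noncomputable def cosetProj (m : ℕ) (D : Coset (codeRound m : Set (WeightTwo m → ZMod 2))) :
    Coset (constantSyndromeCode m : Set (WeightTwo m → ZMod 2)) :=
  cosetOf _ (Function.surjInv cosetOf_surjective D)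

lemma cosetProj_cosetOf (x : WeightTwo m → ZMod 2) :
    cosetProj m (cosetOf _ x) = cosetOf _ x := by
  rw [cosetProj, cosetOf_eq_iff]
  apply codeRound_le_constantSyndromeCode
  rw [← cosetOf_eq_iff]
  exact Function.surjInv_eq _ _

lemma subset_cosetProj (D : Coset (codeRound m : Set (WeightTwo m → ZMod 2))) :
    D.1 ⊆ (cosetProj m D).1 := by
  obtain ⟨x, rfl⟩ := cosetOf_surjective D
  intro y hy
  rw [cosetProj_cosetOf, mem_cosetOf]
  exact codeRound_le_constantSyndromeCode (mem_cosetOf.1 hy)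

theorem cosetProj_isDoubleCover (hm : 6 ≤ m) (hev : Even m) :
    IsDoubleCover (graphRound m)
      (cosetGraph (constantSyndromeCode m : Set (WeightTwo m → ZMod 2))) (cosetProj m) := by
  constructor
  · intro D
    obtain ⟨x, rfl⟩ := cosetOf_surjective D
    -- Translation by a vector of all-one syndrome exchanges the two cosets in a fibre.
    obtain ⟨z, hz, -⟩ := exists_syndrome_eq (v := (1 : Fin m → ZMod 2))
      (by rwa [hammingNorm_one])
    rw [Set.ncard_eq_two]
    refine ⟨cosetOf _ x, cosetOf _ (x + z), ?_, ?_⟩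
    · intro h
      have := cosetOf_eq_iff.1 h.symm
      rw [add_sub_cancel_left, mem_codeRound, hz] at this
      have h1 := hammingNorm_one (m := m)
      rw [this, hammingNorm_zero] at h1
      omega
    · ext E
      obtain ⟨y, rfl⟩ := cosetOf_surjective E
      rw [Set.mem_preimage, Set.mem_singleton_iff, cosetProj_cosetOf, cosetOf_eq_iff,
        mem_constantSyndromeCode, Set.mem_insert_iff, Set.mem_singleton_iff, cosetOf_eq_iff,
        cosetOf_eq_iff, mem_codeRound, mem_codeRound, ← sub_sub, map_sub (syndrome m) (y - x), hz,
        sub_eq_zero (b := (1 : Fin m → ZMod 2))]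
  · intro D
    obtain ⟨x, rfl⟩ := cosetOf_surjective D
    rw [cosetProj_cosetOf]
    refine ⟨?_, ?_, ?_⟩
    · intro E hE
      obtain ⟨e, rfl⟩ := (codeRound_minDist m).adj_iff.1 hE
      rw [cosetProj_cosetOf]
      exact (constantSyndromeCode_minDist hm).adj_iff.2 ⟨e, rfl⟩
    · intro E hE F hF h
      obtain ⟨e, rfl⟩ := (codeRound_minDist m).adj_iff.1 hE
      obtain ⟨f, rfl⟩ := (codeRound_minDist m).adj_iff.1 hF
      rw [cosetProj_cosetOf, cosetProj_cosetOf] at h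
      rw [(constantSyndromeCode_minDist hm).add_single_injective x h]
    · intro E hE
      obtain ⟨e, rfl⟩ := (constantSyndromeCode_minDist hm).adj_iff.1 hE
      exact ⟨cosetOf _ (x + Pi.single e 1), (codeRound_minDist m).adj_iff.2 ⟨e, rfl⟩,
        cosetProj_cosetOf _⟩

end Cover

/-! ### Numbers of cosets -/

section Cardinality

variable {m : ℕ}

/-- The sum of the coordinates as a linear form. -/
def coordSum (m : ℕ) : (Fin m → ZMod 2) →ₗ[ZMod 2] ZMod 2 := ∑ i, LinearMap.proj i

lemma coordSum_apply (v : Fin m → ZMod 2) : coordSum m v = ∑ i, v i := by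
  simp [coordSum]

lemma range_syndrome (m : ℕ) : LinearMap.range (syndrome m) = LinearMap.ker (coordSum m) := by
  ext v
  rw [LinearMap.mem_range, LinearMap.mem_ker, coordSum_apply, ← even_hammingNorm_iff]
  constructor
  · rintro ⟨x, rfl⟩
    exact (hammingNorm_syndrome x).1
  · intro hv
    obtain ⟨x, hx, -⟩ := exists_syndrome_eq hv
    exact ⟨x, hx⟩

lemma card_range_syndrome (hm : 1 ≤ m) :
    Nat.card (LinearMap.range (syndrome m)) = 2 ^ (m - 1) := by
  have hsurj : LinearMap.range (coordSum m) = ⊤ := by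
    rw [LinearMap.range_eq_top]
    intro a
    refine ⟨Pi.single ⟨0, hm⟩ a, ?_⟩
    rw [coordSum_apply]
    simp
  have h := LinearMap.finrank_range_add_finrank_ker (coordSum m)
  rw [hsurj, finrank_top, Module.finrank_self, Module.finrank_fin_fun] at h
  rw [range_syndrome, Module.natCard_eq_pow_finrank (K := ZMod 2), Nat.card_zmod]
  congr 1
  omega

theorem card_coset_codeRound (hm : 1 ≤ m) :
    Nat.card (Coset (codeRound m : Set (WeightTwo m → ZMod 2))) = 2 ^ (m - 1) := by
  rw [← card_range_syndrome hm]
  have h : Setoid.ker (cosetOf (codeRound m)) = Setoid.ker (syndrome m) := by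
    ext x y
    rw [Setoid.ker_def, Setoid.ker_def, cosetOf_eq_iff, mem_codeRound, map_sub, sub_eq_zero]
  rw [← Nat.card_congr (Setoid.quotientKerEquivOfSurjective _ (cosetOf_surjective (C := codeRound m))),
    h]
  exact Nat.card_congr (Setoid.quotientKerEquivRange (syndrome m))

lemma IsDoubleCover.card_eq {V W : Type*} [Finite V] [Finite W] {G : SimpleGraph V}
    {H : SimpleGraph W} {f : V → W} (hf : IsDoubleCover G H f) :
    Nat.card V = 2 * Nat.card W := by
  classical
  have := Fintype.ofFinite W
  rw [← Nat.card_congr (Equiv.sigmaFiberEquiv f), Nat.card_sigma]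
  have : ∀ w, Nat.card {v // f v = w} = 2 := fun w => hf.1 w
  simp [this, mul_comm]

theorem card_coset_constantSyndromeCode (hm : 6 ≤ m) (hev : Even m) :
    Nat.card (Coset (constantSyndromeCode m : Set (WeightTwo m → ZMod 2))) = 2 ^ (m - 2) := by
  have h := (cosetProj_isDoubleCover hm hev).card_eq
  rw [card_coset_codeRound (by omega), show m - 1 = (m - 2) + 1 by omega, pow_succ] at h
  omega

end Cardinality

/-! ### Distance-transitivity -/

section Transitivity

variable {m : ℕ}

lemma hammingNorm_comp_perm (τ : Equiv.Perm (Fin m)) (v : Fin m → ZMod 2) :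
    hammingNorm (v ∘ τ) = hammingNorm v := by
  rw [hammingNorm, hammingNorm]
  exact Finset.card_equiv τ (by simp)

/-- The action of a coordinate permutation on the vectors of weight two. -/
def permWeightTwo (τ : Equiv.Perm (Fin m)) : Equiv.Perm (WeightTwo m) where
  toFun e := ⟨e.1 ∘ τ, by rw [hammingNorm_comp_perm, e.2]⟩
  invFun e := ⟨e.1 ∘ τ.symm, by rw [hammingNorm_comp_perm, e.2]⟩
  left_inv e := by ext i; simp
  right_inv e := by ext i; simp

/-- The inverse on the right is the reason why `τ.symm` is the witness in the transitivity proofs.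
-/
lemma syndrome_comp_perm (τ : Equiv.Perm (Fin m)) (x : WeightTwo m → ZMod 2) :
    syndrome m (x ∘ permWeightTwo τ) = syndrome m x ∘ τ.symm := by
  ext i
  simp only [syndrome, Matrix.mulVecLin_apply, Matrix.mulVec, dotProduct, parityCheck,
    Matrix.of_apply, Function.comp_apply]
  rw [← Equiv.sum_comp (permWeightTwo τ) fun f => f.1 (τ.symm i) * x f]
  simp [permWeightTwo]

lemma exists_perm_comp_eq {u v : Fin m → ZMod 2} (h : hammingNorm u = hammingNorm v) :
    ∃ τ : Equiv.Perm (Fin m), u ∘ τ = v := by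
  have hc : Fintype.card {i // v i ≠ 0} = Fintype.card {i // u i ≠ 0} := by
    rw [Fintype.card_subtype, Fintype.card_subtype]
    exact h.symm
  let τ := (Fintype.equivOfCardEq hc).extendSubtype
  refine ⟨τ, ?_⟩
  ext i
  by_cases hi : v i = 0
  · have := (Fintype.equivOfCardEq hc).extendSubtype_not_mem i (by simpa using hi)
    rw [not_not] at this
    rw [hi]
    exact this
  · have := (Fintype.equivOfCardEq hc).extendSubtype_mem i hi
    rw [zmod_two_eq_one hi]
    exact zmod_two_eq_one this

/-- Translations already act transitively on cosets, so only the stabiliser of the code itself is at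
issue, and coordinate permutations suffice there. -/
lemma isDistanceTransitive_of_perm {C : Submodule (ZMod 2) (WeightTwo m → ZMod 2)}
    (hC : ∀ (τ : Equiv.Perm (Fin m)) (x), x ∘ permWeightTwo τ ∈ C ↔ x ∈ C)
    (htrans : ∀ x x', distTo (C : Set (WeightTwo m → ZMod 2)) x =
      distTo (C : Set (WeightTwo m → ZMod 2)) x' →
      ∃ τ : Equiv.Perm (Fin m), x ∘ permWeightTwo τ - x' ∈ C) :
    IsDistanceTransitive (cosetGraph (C : Set (WeightTwo m → ZMod 2))) := by
  refine ⟨cosetGraph_connected C, fun u v u' v' h => ?_⟩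
  obtain ⟨x, rfl⟩ := cosetOf_surjective u
  obtain ⟨y, rfl⟩ := cosetOf_surjective v
  obtain ⟨x', rfl⟩ := cosetOf_surjective u'
  obtain ⟨y', rfl⟩ := cosetOf_surjective v'
  rw [cosetGraph_dist, cosetGraph_dist] at h
  obtain ⟨τ, hτ⟩ := htrans _ _ h
  let P : Equiv.Perm (WeightTwo m → ZMod 2) := (permWeightTwo τ).symm.arrowCongr (Equiv.refl _)
  have hP : ∀ z, P z = z ∘ permWeightTwo τ := fun z => rfl
  -- Move `x` to `0`, permute, then move `0` to `x'`.
  let g : Equiv.Perm (WeightTwo m → ZMod 2) :=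
    (Equiv.subRight x).trans (P.trans (Equiv.addRight x'))
  have hg : ∀ z, g z = (z - x) ∘ permWeightTwo τ + x' := fun z => rfl
  have hsub : ∀ z w, g z - g w = (z - w) ∘ permWeightTwo τ := by
    intro z w
    rw [hg, hg]
    ext i
    simp
  obtain ⟨π, hπ⟩ := exists_cosetGraph_iso (C := C) g
    (fun z w => by
      rw [hammingDist_eq_norm_sub, hammingDist_eq_norm_sub, hsub, hammingNorm, hammingNorm]
      exact Finset.card_equiv (permWeightTwo τ) (by simp))
    (fun z w => by rw [hsub, hC])
  refine ⟨π, ?_, ?_⟩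
  · rw [hπ, hg]
    congr 1
    ext i
    simp
  · rw [hπ, hg, cosetOf_eq_iff]
    have : (y - x) ∘ permWeightTwo τ + x' - y' = (y - x) ∘ permWeightTwo τ - (y' - x') := by abel
    rw [this]
    exact hτ

lemma comp_perm_eq_const_iff (τ : Equiv.Perm (Fin m)) (v : Fin m → ZMod 2) (a : ZMod 2) :
    v ∘ τ = Function.const _ a ↔ v = Function.const _ a := by
  constructor
  · intro h
    ext i
    simpa using congrFun h (τ.symm i)
  · rintro rfl
    rfl

lemma comp_perm_mem_codeRound (τ : Equiv.Perm (Fin m)) (x : WeightTwo m → ZMod 2) :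
    x ∘ permWeightTwo τ ∈ codeRound m ↔ x ∈ codeRound m := by
  rw [mem_codeRound, mem_codeRound, syndrome_comp_perm]
  exact comp_perm_eq_const_iff _ _ 0

lemma comp_perm_mem_constantSyndromeCode (τ : Equiv.Perm (Fin m)) (x : WeightTwo m → ZMod 2) :
    x ∘ permWeightTwo τ ∈ constantSyndromeCode m ↔ x ∈ constantSyndromeCode m := by
  rw [mem_constantSyndromeCode, mem_constantSyndromeCode, syndrome_comp_perm]
  exact or_congr (comp_perm_eq_const_iff _ _ 0) (comp_perm_eq_const_iff _ _ 1)

theorem graphRound_isDistanceTransitive (m : ℕ) : IsDistanceTransitive (graphRound m) := by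
  refine isDistanceTransitive_of_perm comp_perm_mem_codeRound fun x x' h => ?_
  rw [distTo_codeRound, distTo_codeRound] at h
  obtain ⟨d, hd⟩ := (hammingNorm_syndrome x).1
  obtain ⟨d', hd'⟩ := (hammingNorm_syndrome x').1
  obtain ⟨τ, hτ⟩ := exists_perm_comp_eq
    (show hammingNorm (syndrome m x) = hammingNorm (syndrome m x') by omega)
  refine ⟨τ.symm, ?_⟩
  rw [mem_codeRound, map_sub, syndrome_comp_perm, Equiv.symm_symm, hτ, sub_self]

theorem constantSyndromeCode_isDistanceTransitive (hev : Even m) :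
    IsDistanceTransitive (cosetGraph (constantSyndromeCode m : Set (WeightTwo m → ZMod 2))) := by
  refine isDistanceTransitive_of_perm comp_perm_mem_constantSyndromeCode fun x x' h => ?_
  rw [distTo_constantSyndromeCode hev, distTo_constantSyndromeCode hev] at h
  have h1 := exists_add_one_of_foldedWeight hev (hammingNorm_syndrome x).1 h
  have h2 := exists_add_one_of_foldedWeight hev (hammingNorm_syndrome x').1 rfl
  have h3 := hammingNorm_le (syndrome m x)
  have h4 := hammingNorm_le (syndrome m x')
  have key : hammingNorm (syndrome m x) = hammingNorm (syndrome m x') ∨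
      hammingNorm (syndrome m x) = hammingNorm (syndrome m x' + 1) := by
    rw [hammingNorm_add_one] at h1 h2 ⊢
    omega
  rcases key with key | key
  · obtain ⟨τ, hτ⟩ := exists_perm_comp_eq key
    refine ⟨τ.symm, ?_⟩
    rw [mem_constantSyndromeCode, map_sub, syndrome_comp_perm, Equiv.symm_symm, hτ, sub_self]
    exact .inl rfl
  · obtain ⟨τ, hτ⟩ := exists_perm_comp_eq key
    refine ⟨τ.symm, ?_⟩
    rw [mem_constantSyndromeCode, map_sub, syndrome_comp_perm, Equiv.symm_symm, hτ,
      add_sub_cancel_left]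
    exact .inr rfl

end Transitivity

/-! ### Primitivity and imprimitivity -/

section Primitivity

variable {m : ℕ}

lemma distanceGraph_adj_add {ι : Type*} [Fintype ι] {C : Submodule (ZMod 2) (ι → ZMod 2)} {i : ℕ}
    (hi : 1 ≤ i) (x : ι → ZMod 2) {a : ι → ZMod 2}
    (ha : distTo (C : Set (ι → ZMod 2)) a = i) :
    (distanceGraph (cosetGraph (C : Set (ι → ZMod 2))) i).Adj (cosetOf C x)
      (cosetOf C (x + a)) := by
  have hd : (cosetGraph (C : Set (ι → ZMod 2))).dist (cosetOf C x) (cosetOf C (x + a)) = i := by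
    rw [cosetGraph_dist, add_sub_cancel_left, ha]
  refine ⟨fun h => ?_, hd⟩
  rw [← h, SimpleGraph.dist_self] at hd
  omega

/-- A pair `{p, q}` is the symmetric difference of two `2i`-sets `R ∪ {p}` and `R ∪ {q}`, so each
edge of the coset graph is a path of two edges in the distance-`i` graph. -/
theorem constantSyndromeCode_isPrimitive (hm : 6 ≤ m) (hev : Even m) :
    IsPrimitive (cosetGraph (constantSyndromeCode m : Set (WeightTwo m → ZMod 2))) := by
  refine ⟨cosetGraph_connected _, fun i h1 hi => ?_⟩
  rw [(constantSyndromeCode_regular hm hev).2.diam_eq] at hi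
  have : Nonempty (Coset (constantSyndromeCode m : Set (WeightTwo m → ZMod 2))) :=
    ⟨cosetOf _ 0⟩
  have hfw : ∀ T : Finset (Fin m), T.card = 2 * i → ∃ a, syndrome m a = charVec T ∧
      distTo (constantSyndromeCode m : Set (WeightTwo m → ZMod 2)) a = i := by
    intro T hT
    obtain ⟨a, ha, -⟩ := exists_syndrome_eq (v := charVec T)
      (by rw [hammingNorm_charVec, hT]; exact even_two_mul i)
    refine ⟨a, ha, ?_⟩
    rw [distTo_constantSyndromeCode hev, ha, foldedWeight, hammingNorm_charVec]
    omega
  have step : ∀ x (e : WeightTwo m),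
      (distanceGraph (cosetGraph (constantSyndromeCode m : Set (WeightTwo m → ZMod 2))) i).Reachable
        (cosetOf _ x) (cosetOf _ (x + Pi.single e 1)) := by
    intro x e
    obtain ⟨p, q, hpq, he⟩ := Finset.card_eq_two.1 (show (supp e.1).card = 2 from e.2)
    -- There is room for `R` because `i ≤ m / 4` gives `2i - 1 ≤ m - 2`.
    obtain ⟨R, hR, hRc⟩ := Finset.exists_subset_card_eq (s := (supp e.1)ᶜ) (n := 2 * i - 1)
      (by rw [Finset.card_compl, Fintype.card_fin, card_supp, e.2]; omega)
    have hdisj : ∀ k ∈ R, k ≠ p ∧ k ≠ q := by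
      intro k hk
      have := hR hk
      rw [he] at this
      simpa using this
    have hp : p ∉ R := fun h => (hdisj p h).1 rfl
    have hq : q ∉ R := fun h => (hdisj q h).2 rfl
    obtain ⟨a, ha, hda⟩ := hfw (insert p R) (by rw [Finset.card_insert_of_notMem hp]; omega)
    obtain ⟨b, hb, hdb⟩ := hfw (insert q R) (by rw [Finset.card_insert_of_notMem hq]; omega)
    have hab : cosetOf (constantSyndromeCode m) (x + a + b) = cosetOf _ (x + Pi.single e 1) := by
      rw [cosetOf_eq_iff, mem_constantSyndromeCode]
      left
      have h2 : charVec (insert p R) + charVec (insert q R) = e.1 := by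
        rw [← charVec_supp (charVec _ + charVec _), ← charVec_supp e.1, supp_add, supp_charVec,
          supp_charVec, he]
        congr 1
        ext k
        have := hdisj k
        simp only [Finset.mem_symmDiff, Finset.mem_insert, Finset.mem_singleton]
        by_cases hk : k ∈ R <;> by_cases h1 : k = p <;> by_cases h2 : k = q <;> simp_all
      rw [add_assoc, add_sub_add_left_eq_sub, map_sub, map_add, ha, hb, h2, syndrome_single,
        sub_self]
    rw [← hab]
    exact (distanceGraph_adj_add h1 x hda).reachable.trans
      (distanceGraph_adj_add h1 (x + a) hdb).reachable
  have reach : ∀ (n : ℕ) x z, hammingNorm z = n →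
      (distanceGraph (cosetGraph (constantSyndromeCode m : Set (WeightTwo m → ZMod 2))) i).Reachable
        (cosetOf _ x) (cosetOf _ (x + z)) := by
    intro n
    induction n with
    | zero =>
      intro x z hz
      rw [hammingNorm_eq_zero.1 hz, add_zero]
    | succ n ih =>
      intro x z hz
      obtain ⟨z', e, rfl, hz'⟩ := exists_eq_add_single (z := z) (by rintro rfl; simp at hz)
      rw [← add_assoc]
      exact (ih x z' (by omega)).trans (step _ e)
  refine ⟨fun u v => ?_⟩
  obtain ⟨x, rfl⟩ := cosetOf_surjective u
  obtain ⟨y, rfl⟩ := cosetOf_surjective v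
  have := reach _ x (y - x) rfl
  rwa [add_sub_cancel] at this

theorem graphRound_not_isPrimitive (hm : 6 ≤ m) (hev : Even m) : ¬ IsPrimitive (graphRound m) := by
  rintro ⟨-, h⟩
  rw [(codeRound_regular hev).2.diam_eq] at h
  have hc := h (m / 2) (by omega) le_rfl
  -- Cosets at distance `m / 2` differ by the all-one syndrome, so walks in this distance graph stay
  -- within a fibre.
  have hwalk : ∀ D D', (distanceGraph (graphRound m) (m / 2)).Walk D D' →
      cosetProj m D = cosetProj m D' := by
    intro D D' w
    induction w with
    | nil => rfl
    | @cons D D₁ D' hadj w ih =>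
      rw [← ih]
      obtain ⟨x, rfl⟩ := cosetOf_surjective D
      obtain ⟨y, rfl⟩ := cosetOf_surjective D₁
      have hd := hadj.2
      rw [cosetGraph_dist, distTo_codeRound] at hd
      rw [cosetProj_cosetOf, cosetProj_cosetOf, eq_comm, cosetOf_eq_iff, mem_constantSyndromeCode]
      right
      obtain ⟨d, hd'⟩ := (hammingNorm_syndrome (y - x)).1
      obtain ⟨n, hn⟩ := hev
      exact eq_one_of_hammingNorm (by omega)
  obtain ⟨v, hv⟩ := exists_weight (m := m) (k := 2) (by omega)
  obtain ⟨x, hx, -⟩ := exists_syndrome_eq (v := v) (by rw [hv]; exact even_two)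
  obtain ⟨w⟩ := hc.preconnected (cosetOf _ x) (cosetOf _ 0)
  have hw := hwalk _ _ w
  rw [cosetProj_cosetOf, cosetProj_cosetOf, cosetOf_eq_iff, sub_zero, mem_constantSyndromeCode,
    hx] at hw
  rcases hw with rfl | rfl
  · rw [hammingNorm_zero] at hv
    omega
  · rw [hammingNorm_one] at hv
    omega

end Primitivity

/-! ### Eigenvalues through characters of the cube -/

section Eigenvalues

lemma MinDistThree.mem_eigenvalues_iff {ι : Type*} [Fintype ι] [DecidableEq ι]
    {C : Submodule (ZMod 2) (ι → ZMod 2)} (hC : MinDistThree C) {θ : ℝ} :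
    θ ∈ eigenvalues (cosetGraph (C : Set (ι → ZMod 2))) ↔
      ∃ f : Coset (C : Set (ι → ZMod 2)) → ℝ, f ≠ 0 ∧
        ∀ x, ∑ j, f (cosetOf C (x + Pi.single j 1)) = θ * f (cosetOf C x) := by
  classical
  have key : ∀ (f : Coset (C : Set (ι → ZMod 2)) → ℝ) x,
      ((cosetGraph (C : Set (ι → ZMod 2))).adjMatrix ℝ).mulVec f (cosetOf C x) =
        ∑ j, f (cosetOf C (x + Pi.single j 1)) := by
    intro f x
    rw [SimpleGraph.adjMatrix_mulVec_apply]
    symm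
    refine Finset.sum_bij (fun j _ => cosetOf C (x + Pi.single j 1)) ?_ ?_ ?_ ?_
    · intro j _
      rw [SimpleGraph.mem_neighborFinset]
      exact hC.adj_iff.2 ⟨j, rfl⟩
    · intro j _ k _ h
      exact hC.add_single_injective x h
    · intro D hD
      rw [SimpleGraph.mem_neighborFinset, hC.adj_iff] at hD
      obtain ⟨j, rfl⟩ := hD
      exact ⟨j, Finset.mem_univ _, rfl⟩
    · intro j _
      rfl
  have heig : ∀ f : Coset (C : Set (ι → ZMod 2)) → ℝ,
      ((cosetGraph (C : Set (ι → ZMod 2))).adjMatrix ℝ).mulVec f = θ • f ↔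
        ∀ x, ∑ j, f (cosetOf C (x + Pi.single j 1)) = θ * f (cosetOf C x) := by
    intro f
    constructor
    · intro h x
      rw [← key, h, Pi.smul_apply, smul_eq_mul]
    · intro h
      ext D
      obtain ⟨x, rfl⟩ := cosetOf_surjective D
      rw [key, h, Pi.smul_apply, smul_eq_mul]
  have hmem : θ ∈ eigenvalues (cosetGraph (C : Set (ι → ZMod 2))) ↔
      ∃ f : Coset (C : Set (ι → ZMod 2)) → ℝ, f ≠ 0 ∧
        ((cosetGraph (C : Set (ι → ZMod 2))).adjMatrix ℝ).mulVec f = θ • f := by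
    constructor
    · intro h
      obtain ⟨f, hf⟩ := Module.End.HasEigenvalue.exists_hasEigenvector h
      refine ⟨f, hf.2, ?_⟩
      have := hf.apply_eq_smul
      rw [Matrix.toLin'_apply] at this
      convert this
    · rintro ⟨f, h0, hf⟩
      refine Module.End.hasEigenvalue_of_hasEigenvector (x := f) ⟨?_, h0⟩
      rw [Module.End.mem_eigenspace_iff, Matrix.toLin'_apply]
      convert hf
  simp only [hmem, heig]

variable {m : ℕ}

/-- The nontrivial real character of the field with two elements. -/
def signChar (a : ZMod 2) : ℝ := if a = 0 then 1 else -1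

lemma signChar_add (a b : ZMod 2) : signChar (a + b) = signChar a * signChar b := by
  by_cases ha : a = 0
  · simp [signChar, ha]
  · by_cases hb : b = 0
    · simp [signChar, hb]
    · rw [zmod_two_eq_one ha, zmod_two_eq_one hb]
      simp [signChar, CharTwo.add_self_eq_zero]

/-- The character of `𝔽₂ᵐ` given by a set of coordinates. -/
noncomputable def cubeChar (S : Finset (Fin m)) (v : Fin m → ZMod 2) : ℝ := ∏ i ∈ S, signChar (v i)

lemma cubeChar_add (S : Finset (Fin m)) (u v : Fin m → ZMod 2) :
    cubeChar S (u + v) = cubeChar S u * cubeChar S v := by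
  simp only [cubeChar, Pi.add_apply, signChar_add, Finset.prod_mul_distrib]

lemma cubeChar_eq (S : Finset (Fin m)) (v : Fin m → ZMod 2) :
    cubeChar S v = (-1) ^ (S ∩ supp v).card := by
  have h : S ∩ supp v = S.filter fun i => v i ≠ 0 := by
    ext i
    simp [mem_supp]
  rw [cubeChar, h, ← Finset.prod_const, Finset.prod_filter]
  refine Finset.prod_congr rfl fun i _ => ?_
  by_cases hi : v i = 0 <;> simp [signChar, hi]

lemma cubeChar_zero (S : Finset (Fin m)) : cubeChar S 0 = 1 := by
  simp [cubeChar, signChar]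

lemma cubeChar_one (S : Finset (Fin m)) : cubeChar S 1 = (-1) ^ S.card := by
  simp [cubeChar, signChar]

lemma sum_cubeChar_weightTwo (S : Finset (Fin m)) :
    ∑ e : WeightTwo m, cubeChar S e.1 =
      2 * ((S.card.choose 2 : ℝ) + ((m - S.card).choose 2 : ℝ)) - (m.choose 2 : ℝ) := by
  have hcount : ∀ T : Finset (Fin m),
      ∑ e : WeightTwo m, (if supp e.1 ⊆ T then (1 : ℝ) else 0) = (T.card.choose 2 : ℝ) := by
    intro T
    rw [Finset.sum_boole, ← ncard_supp_subset, Set.ncard_eq_toFinset_card']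
    simp
  -- The value is `1` if the pair lies in `S` or in its complement, and `-1` otherwise. The constant
  -- `1` is written as an indicator so that `hcount` evaluates all three sums.
  have hval : ∀ e : WeightTwo m, cubeChar S e.1 =
      2 * ((if supp e.1 ⊆ S then (1 : ℝ) else 0) + (if supp e.1 ⊆ Sᶜ then (1 : ℝ) else 0)) -
        (if supp e.1 ⊆ Finset.univ then (1 : ℝ) else 0) := by
    intro e
    have h0 := card_inter_eq_zero_iff (charVec S) e
    have h2 := card_inter_eq_two_iff (charVec S) e
    have hle := (hammingNorm_add_weightTwo (charVec S) e).2
    rw [supp_charVec] at h0 h2 hle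
    rw [cubeChar_eq, if_pos (Finset.subset_univ _)]
    simp only [← h0, ← h2]
    generalize (S ∩ supp e.1).card = k at *
    interval_cases k <;> norm_num
  rw [Finset.sum_congr rfl fun e _ => hval e, Finset.sum_sub_distrib, ← Finset.mul_sum,
    Finset.sum_add_distrib, hcount, hcount, hcount, Finset.card_compl, Finset.card_univ,
    Fintype.card_fin]

/-- The characters separate functions on the cube. -/
lemma exists_cubeChar_coeff_ne_zero {G : (Fin m → ZMod 2) → ℝ} (hG : G ≠ 0) :
    ∃ S, ∑ v, G v * cubeChar S v ≠ 0 := by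
  by_contra! h
  apply hG
  ext w
  have h1 : ∑ S, cubeChar S w * ∑ v, G v * cubeChar S v = 0 := by simp [h]
  -- Orthogonality: the sum over all `S` expands `∏ (1 + signChar (u i))`, which vanishes as soon as
  -- some `u i = 1`. Fourier inversion in `h3` follows.
  have h2 : ∀ u : Fin m → ZMod 2, ∑ S, cubeChar S u = if u = 0 then (2 : ℝ) ^ m else 0 := by
    intro u
    have := Finset.prod_one_add (f := fun i => signChar (u i)) Finset.univ
    rw [Finset.powerset_univ] at this
    unfold cubeChar
    rw [← this]
    split_ifs with hu
    · subst hu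
      norm_num [signChar]
    · obtain ⟨j, hj⟩ := Function.ne_iff.1 hu
      refine Finset.prod_eq_zero (Finset.mem_univ j) ?_
      rw [signChar, if_neg (show u j ≠ 0 from hj)]
      norm_num
  have h3 : ∑ S, cubeChar S w * ∑ v, G v * cubeChar S v = G w * 2 ^ m := by
    simp only [Finset.mul_sum]
    rw [Finset.sum_comm]
    rw [Finset.sum_eq_single w]
    · rw [Finset.sum_congr rfl fun S _ => show cubeChar S w * (G w * cubeChar S w) =
        G w * cubeChar S (w + w) by rw [cubeChar_add]; ring, ← Finset.mul_sum, h2,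
        add_self_eq_zero, if_pos rfl]
    · intro v _ hv
      rw [Finset.sum_congr rfl fun S _ => show cubeChar S w * (G v * cubeChar S v) =
        G v * cubeChar S (v + w) by rw [cubeChar_add]; ring, ← Finset.mul_sum, h2, if_neg,
        mul_zero]
      rwa [← sub_eq_add_vec, sub_eq_zero]
    · simp
  rw [h3] at h1
  simpa using h1

theorem mem_eigenvalues_constantSyndromeCode (hm : 6 ≤ m) (hev : Even m) {θ : ℝ} :
    θ ∈ eigenvalues (cosetGraph (constantSyndromeCode m : Set (WeightTwo m → ZMod 2))) ↔
      ∃ s : ℕ, s ≤ m ∧ Even s ∧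
        θ = 2 * ((s.choose 2 : ℝ) + ((m - s).choose 2 : ℝ)) - (m.choose 2 : ℝ) := by
  rw [(constantSyndromeCode_minDist hm).mem_eigenvalues_iff]
  constructor
  · rintro ⟨f, hf0, hf⟩
    -- The eigenvector is transported to syndromes and extended by zero to odd weights, so that
    -- Fourier analysis on the whole cube applies.
    let G : (Fin m → ZMod 2) → ℝ := fun v =>
      if h : Even (hammingNorm v) then f (cosetOf _ (exists_syndrome_eq h).choose) else 0
    have hGs : ∀ x, G (syndrome m x) = f (cosetOf _ x) := by
      intro x
      have h := (hammingNorm_syndrome x).1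
      simp only [G, dif_pos h]
      congr 1
      rw [cosetOf_eq_iff, mem_constantSyndromeCode, map_sub,
        (exists_syndrome_eq h).choose_spec.1, sub_self]
      exact .inl rfl
    have hGodd : ∀ v, ¬ Even (hammingNorm v) → G v = 0 := fun v h => dif_neg h
    have hG1 : ∀ v, G (v + 1) = G v := by
      intro v
      have hev1 : Even (hammingNorm (1 : Fin m → ZMod 2)) := by rwa [hammingNorm_one]
      by_cases h : Even (hammingNorm v)
      · obtain ⟨x, rfl, -⟩ := exists_syndrome_eq h
        obtain ⟨z, hz, -⟩ := exists_syndrome_eq hev1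
        rw [← hz, ← map_add, hGs, hGs]
        congr 1
        rw [cosetOf_eq_iff, mem_constantSyndromeCode, add_sub_cancel_left, hz]
        exact .inr rfl
      · rw [hGodd v h, hGodd]
        rwa [add_comm, even_hammingNorm_add hev1]
    have hGe : ∀ v, ∑ e : WeightTwo m, G (v + e.1) = θ * G v := by
      intro v
      by_cases h : Even (hammingNorm v)
      · obtain ⟨x, rfl, -⟩ := exists_syndrome_eq h
        rw [hGs, ← hf]
        refine Finset.sum_congr rfl fun e _ => ?_
        rw [← hGs, map_add, syndrome_single]
      · rw [hGodd v h, mul_zero]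
        refine Finset.sum_eq_zero fun e _ => hGodd _ ?_
        rwa [add_comm, even_hammingNorm_add (even_hammingNorm_weightTwo e)]
    have hG0 : G ≠ 0 := by
      intro h0
      apply hf0
      ext D
      obtain ⟨x, rfl⟩ := cosetOf_surjective D
      rw [← hGs, h0]
      rfl
    -- At a nonzero Fourier coefficient, invariance under the all-one vector forces `|S|` even, and
    -- the eigenvector equation forces `θ` to be the sum of the character over the pairs.
    obtain ⟨S, hS⟩ := exists_cubeChar_coeff_ne_zero hG0
    have hshift : ∀ a : Fin m → ZMod 2,
        ∑ v, G (v + a) * cubeChar S v = cubeChar S a * ∑ v, G v * cubeChar S v := by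
      intro a
      rw [← Equiv.sum_comp (Equiv.addRight a) fun v => G v * cubeChar S v, Finset.mul_sum]
      refine Finset.sum_congr rfl fun v _ => ?_
      have h1 : cubeChar S a * cubeChar S a = 1 := by
        rw [← cubeChar_add, add_self_eq_zero, cubeChar_zero]
      rw [Equiv.coe_addRight, cubeChar_add]
      linear_combination (- G (v + a) * cubeChar S v) * h1
    refine ⟨S.card, by simpa using Finset.card_le_univ S, ?_, ?_⟩
    · have h := hshift 1
      simp only [hG1] at h
      have h1 : cubeChar S 1 = 1 := (mul_eq_right₀ hS).1 h.symm
      rw [cubeChar_one] at h1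
      exact (neg_one_pow_eq_one_iff_even (by norm_num)).1 h1
    · rw [← sum_cubeChar_weightTwo]
      apply mul_right_cancel₀ hS
      rw [Finset.sum_mul, ← Finset.sum_congr rfl fun e _ => hshift (Subtype.val e), Finset.sum_comm,
        Finset.mul_sum]
      refine Finset.sum_congr rfl fun v _ => ?_
      rw [← Finset.sum_mul, hGe, mul_assoc]
  · rintro ⟨s, hs, hse, rfl⟩
    obtain ⟨v, hv⟩ := exists_weight hs
    let S := supp v
    have hS1 : cubeChar S 1 = 1 := by
      rw [cubeChar_one, card_supp, hv]
      exact hse.neg_one_pow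
    -- Since `|S|` is even, the character is trivial on the all-one vector, so its value does not
    -- depend on the chosen representative.
    let f : Coset (constantSyndromeCode m : Set (WeightTwo m → ZMod 2)) → ℝ := fun D =>
      cubeChar S (syndrome m (Function.surjInv cosetOf_surjective D))
    have hf : ∀ x, f (cosetOf _ x) = cubeChar S (syndrome m x) := by
      intro x
      have h := cosetOf_eq_iff.1
        (Function.surjInv_eq (cosetOf_surjective (C := constantSyndromeCode m)) (cosetOf _ x))
      rw [mem_constantSyndromeCode, map_sub] at h
      simp only [f]
      rcases h with h | h
      · rw [sub_eq_zero.1 h]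
      · rw [sub_eq_iff_eq_add.1 h, cubeChar_add, hS1, one_mul]
    refine ⟨f, fun h0 => ?_, fun x => ?_⟩
    · have := hf 0
      rw [h0, map_zero, cubeChar_zero] at this
      simp at this
    · simp only [hf, map_add, syndrome_single, cubeChar_add]
      rw [← Finset.mul_sum, sum_cubeChar_weightTwo, card_supp, hv, mul_comm]

lemma eigenvalue_formula {s : ℕ} (hs : s ≤ m) :
    2 * ((s.choose 2 : ℝ) + ((m - s).choose 2 : ℝ)) - (m.choose 2 : ℝ) =
      (m.choose 2 : ℝ) - 2 * s * (m - s) := by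
  rw [Nat.cast_choose_two, Nat.cast_choose_two, Nat.cast_choose_two, Nat.cast_sub hs]
  ring

theorem eigenvalues_constantSyndromeCode (hm : 6 ≤ m) (hev : Even m) :
    eigenvalues (cosetGraph (constantSyndromeCode m : Set (WeightTwo m → ZMod 2))) =
      {θ : ℝ | ∃ i : ℕ, i ≤ m / 4 ∧
        θ = (m.choose 2 : ℝ) - 8 * (i : ℝ) * (((m / 2 : ℕ) : ℝ) - (i : ℝ))} := by
  obtain ⟨n, hn⟩ := hev
  have hmn : (m : ℝ) = n + n := by exact_mod_cast hn
  have hn2 : m / 2 = n := by omega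
  ext θ
  rw [mem_eigenvalues_constantSyndromeCode hm ⟨n, hn⟩, Set.mem_ofPred_eq, hn2]
  constructor
  · rintro ⟨s, hs, ⟨k, hk⟩, rfl⟩
    have hsk : (s : ℝ) = k + k := by exact_mod_cast hk
    rw [eigenvalue_formula hs, hsk, hmn]
    by_cases hkn : k ≤ m / 4
    · exact ⟨k, hkn, by ring⟩
    -- The eigenvalue is symmetric under `s ↦ m - s`, that is `k ↦ n - k`, which brings the index
    -- into the range up to `m / 4`.
    · refine ⟨n - k, by omega, ?_⟩
      rw [Nat.cast_sub (by omega)]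
      ring
  · rintro ⟨i, hi, rfl⟩
    refine ⟨i + i, by omega, ⟨i, rfl⟩, ?_⟩
    rw [eigenvalue_formula (by omega), hmn]
    push_cast
    ring

end Eigenvalues

end CosetCode

theorem mainTheorem3 (m : ℕ) (hm : 6 ≤ m) (hev : Even m) :
    -- the code `C^{[m]}` is linear
    (∃ S : Submodule (ZMod 2) (CosetCode.WeightTwo m → ZMod 2),
      (S : Set (CosetCode.WeightTwo m → ZMod 2)) = CosetCode.codeSquare m) ∧
    -- numbers of vertices, and the double cover given by inclusion of cosets
    Nat.card (CosetCode.Coset (CosetCode.codeRound m : Set (CosetCode.WeightTwo m → ZMod 2)))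
      = 2 ^ (m - 1) ∧
    Nat.card (CosetCode.Coset (CosetCode.codeSquare m)) = 2 ^ (m - 2) ∧
    (∃ f : CosetCode.Coset (CosetCode.codeRound m : Set (CosetCode.WeightTwo m → ZMod 2)) →
        CosetCode.Coset (CosetCode.codeSquare m),
      (∀ D, D.1 ⊆ (f D).1) ∧
      CosetCode.IsDoubleCover (CosetCode.graphRound m) (CosetCode.graphSquare m) f) ∧
    -- the codes and their coset graphs have the same explicit intersection arrays
    CosetCode.IsCompletelyRegularWith
      (CosetCode.codeRound m : Set (CosetCode.WeightTwo m → ZMod 2)) (m / 2)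
      (CosetCode.arrB m) CosetCode.arrC ∧
    CosetCode.IsDistanceRegularWith (CosetCode.graphRound m) (m / 2)
      (CosetCode.arrB m) CosetCode.arrC ∧
    CosetCode.IsCompletelyRegularWith (CosetCode.codeSquare m) (m / 4)
      (CosetCode.arrB m) (CosetCode.arrCSquare m) ∧
    CosetCode.IsDistanceRegularWith (CosetCode.graphSquare m) (m / 4)
      (CosetCode.arrB m) (CosetCode.arrCSquare m) ∧
    -- distance-transitivity
    CosetCode.IsDistanceTransitive (CosetCode.graphRound m) ∧
    CosetCode.IsDistanceTransitive (CosetCode.graphSquare m) ∧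
    -- imprimitivity and primitivity
    ¬ CosetCode.IsPrimitive (CosetCode.graphRound m) ∧
    CosetCode.IsPrimitive (CosetCode.graphSquare m) ∧
    -- eigenvalues
    (m % 4 = 2 → CosetCode.eigenvalues (CosetCode.graphSquare m) =
      {θ : ℝ | ∃ i : ℕ, i ≤ m / 4 ∧
        θ = (m.choose 2 : ℝ) - 8 * (i : ℝ) * (2 * ((m / 4 : ℕ) : ℝ) + 1 - (i : ℝ))}) ∧
    (m % 4 = 0 → CosetCode.eigenvalues (CosetCode.graphSquare m) =
      {θ : ℝ | ∃ i : ℕ, i ≤ m / 4 ∧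
        θ = (m.choose 2 : ℝ) - 8 * (i : ℝ) * (2 * ((m / 4 : ℕ) : ℝ) - (i : ℝ))}) := by
  have hcs := CosetCode.coe_constantSyndromeCode hev
  have hr := CosetCode.codeRound_regular hev
  have hsq := CosetCode.constantSyndromeCode_regular hm hev
  have heig := CosetCode.eigenvalues_constantSyndromeCode hm hev
  refine ⟨⟨_, hcs⟩, ?_⟩
  simp only [CosetCode.graphSquare]
  -- The cosets and their graph depend only on the underlying set, so every claim about `C^{[m]}`
  -- passes to the linear code.
  rw [← hcs]
  refine ⟨CosetCode.card_coset_codeRound (by omega),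
    CosetCode.card_coset_constantSyndromeCode hm hev,
    ⟨CosetCode.cosetProj m, CosetCode.subset_cosetProj, CosetCode.cosetProj_isDoubleCover hm hev⟩,
    hr.1, hr.2, hsq.1, hsq.2, CosetCode.graphRound_isDistanceTransitive m,
    CosetCode.constantSyndromeCode_isDistanceTransitive hev,
    CosetCode.graphRound_not_isPrimitive hm hev, CosetCode.constantSyndromeCode_isPrimitive hm hev,
    fun h => ?_, fun h => ?_⟩
  · rw [heig, show m / 2 = 2 * (m / 4) + 1 by omega]
    push_cast
    rfl
  · rw [heig, show m / 2 = 2 * (m / 4) by omega]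
    push_cast
    rfl
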